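/- Let $A_3=\{0,1,2\}$, let $A_3^*$ be the free monoid of finite words over $A_3$, with empty word $\varepsilon$, and let $|w|_a$ be the number of occurrences of the letter $a$ in the word $w$. An infinite word is Sturmian if for every $n\in\mathbb{N}$ it has exactly $n+1$ distinct factors of length $n$. An infinite word $x\in A_3^{\mathbb{N}}$ is a word with Sturmian erasures if, for each $a\in A_3$, deleting all occurrences of $a$ from $x$ gives an (infinite) Sturmian word. A morphism $f:A_3\to A_3^*$ (extended to finite and infinite words by concatenation) is a morphism with Sturmian erasures if $f(x)$ is a word with Sturmian erasures for every word $x$ with Sturmian erasures. For $i\in A_3$, let $\mathrm{MSE}_i$ be the set of morphisms $f$ with Sturmian erasures such that $f(i)=\varepsilon$. For a morphism $f:A_3\to A_3^*$, a letter $a$ is nilpotent if $f^n(a)=\varepsilon$ for some $n$. Let $\mathcal N_f$ be the set of nilpotent letters, and let $\mathcal P'_f$ be the set of letters $a$ such that, for some $n\ge 1$, deleting the letters of $\mathcal N_f$ from $f^n(a)$ gives the word $a$. A letter $a$ is permuting if $f^n(a)\in(\mathcal N_f\cup\mathcal P'_f)^*\setminus\mathcal N_f^*$ for some $n\geq 0$,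 and expansive if it is neither nilpotent nor permuting. The morphism $f$ is nilpotent if there is an $n$ with $f^n(a)=\varepsilon$ for all $a\in A_3$; it is expansive if there is an expansive letter; and it is a unit if it is neither nilpotent nor expansive. A morphism $f\in\mathrm{MSE}_i$ is prime in $\mathrm{MSE}_i$ if, whenever $f=g\circ h$ with $g,h\in\mathrm{MSE}_i$, at least one of $g,h$ is a unit. Proposition. Let $A_3=\{i,j,k\}$ and $f\in\mathrm{MSE}_i$. (1) If $f(j)$ is neither a prefix nor a suffix of $f(k)$ and $f(k)$ is neither a prefix nor a suffix of $f(j)$, then $f$ is prime in $\mathrm{MSE}_i$. (2) If $f$ is prime in $\mathrm{MSE}_i$ and $|f(012)|_j>|f(012)|_k\ge|f(012)|_i$, then $f(j)$ is neither a prefix nor a suffix of $f(k)$ and $f(k)$ is neither a prefix nor a suffix of $f(j)$. -/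

import Mathlib

namespace SturmianErasures

/-- Morphisms of the free monoid `A*`. Such a morphism is the same thing as a map `A → A*`; the
product `g * h` is the composition `g ∘ h` and `f ^ n` is the `n`-th iterate of `f`. -/
abbrev Morphism (A : Type*) := Monoid.End (FreeMonoid A)

section Words

variable {A : Type*}

/-- The finite word `x_m x_{m+1} ⋯ x_{m+n-1}` of an infinite word `x`. -/
def wordSegment (x : ℕ → A) (m n : ℕ) : FreeMonoid A :=
  FreeMonoid.ofList (List.ofFn fun t : Fin n => x (m + t))

/-- The complexity function `P_x`: the number of factors of length `n` of `x`. -/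
noncomputable def complexity (x : ℕ → A) (n : ℕ) : ℕ :=
  (Set.range fun m => wordSegment x m n).ncard

/-- An infinite word is Sturmian if it has exactly `n + 1` factors of length `n`, for all `n`. -/
def IsSturmian (x : ℕ → A) : Prop :=
  ∀ n, complexity x n = n + 1

/-- `f(x)` is an infinite word and is equal to `y`: the images of the prefixes of `x` are prefixes
of `y` and their lengths are unbounded. (If the lengths are bounded then `f(x)` is a finite word,
and the relation holds for no `y`.) -/
def IsInfiniteImage (f : Morphism A) (x y : ℕ → A) : Prop :=
  (∀ n, f (wordSegment x 0 n) = wordSegment y 0 (f (wordSegment x 0 n)).length) ∧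
    ∀ N, ∃ n, N ≤ (f (wordSegment x 0 n)).length

open Classical in
/-- The morphism that erases the letters of `S` and fixes all other letters. -/
noncomputable def erase (S : Set A) : Morphism A :=
  FreeMonoid.lift fun b => if b ∈ S then 1 else FreeMonoid.of b

/-- `u` is a prefix of `w`. -/
def IsWordPrefix (u w : FreeMonoid A) : Prop :=
  ∃ v, w = u * v

/-- `u` is a suffix of `w`. -/
def IsWordSuffix (u w : FreeMonoid A) : Prop :=
  ∃ v, w = v * u

/-- `|w|_a`, the number of occurrences of the letter `a` in the word `w`. -/
def occurrences [DecidableEq A] (a : A) (w : FreeMonoid A) : ℕ :=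
  (FreeMonoid.toList w).count a

end Words

section Units

variable {A : Type*}

/-- The set of `f`-nilpotent letters. -/
def nilpotentLetters (f : Morphism A) : Set A :=
  {a | ∃ n : ℕ, (f ^ n) (FreeMonoid.of a) = 1}

/-- The letters `a` that some iterate `f ^ n`, `n ≥ 1`, maps to `a` up to erasing nilpotent
letters. -/
def returningLetters (f : Morphism A) : Set A :=
  {a | ∃ n : ℕ, 1 ≤ n ∧ erase (nilpotentLetters f) ((f ^ n) (FreeMonoid.of a)) = FreeMonoid.of a}

/-- The set of `f`-permuting letters: some iterate of `f` maps `a` to a word all of whose letters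
are nilpotent or returning, and not all of whose letters are nilpotent. -/
def permutingLetters (f : Morphism A) : Set A :=
  {a | ∃ n : ℕ,
    (∀ b ∈ (f ^ n) (FreeMonoid.of a), b ∈ nilpotentLetters f ∪ returningLetters f) ∧
      ¬ ∀ b ∈ (f ^ n) (FreeMonoid.of a), b ∈ nilpotentLetters f}

/-- A letter is `f`-expansive if it is neither nilpotent nor permuting. -/
def expansiveLetters (f : Morphism A) : Set A :=
  {a | a ∉ nilpotentLetters f ∧ a ∉ permutingLetters f}

/-- `f` is nilpotent if some iterate of `f` maps every letter to the empty word. -/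
def IsNilpotentMorphism (f : Morphism A) : Prop :=
  ∃ n : ℕ, ∀ a, (f ^ n) (FreeMonoid.of a) = 1

/-- `f` is expansive if there is an `f`-expansive letter. -/
def IsExpansiveMorphism (f : Morphism A) : Prop :=
  (expansiveLetters f).Nonempty

/-- `f` is a unit if it is neither nilpotent nor expansive. (This is not invertibility.) -/
def IsUnitMorphism (f : Morphism A) : Prop :=
  ¬ IsNilpotentMorphism f ∧ ¬ IsExpansiveMorphism f

/-- `f ∈ M` is prime in `M` if, whenever `f = g ∘ h` with `g, h ∈ M`, one of `g`, `h` is a unit. -/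
def IsPrimeIn (M : Set (Morphism A)) (f : Morphism A) : Prop :=
  f ∈ M ∧ ∀ g ∈ M, ∀ h ∈ M, f = g * h → IsUnitMorphism g ∨ IsUnitMorphism h

end Units

/-- The set of infinite words over `A_3 = {0, 1, 2}` with Sturmian erasures: for every letter `i`,
erasing `i` gives a Sturmian word. -/
def WSE : Set (ℕ → Fin 3) :=
  {x | ∀ i, ∃ y, IsInfiniteImage (erase {i}) x y ∧ IsSturmian y}

/-- The set of morphisms with Sturmian erasures: those that map every word with Sturmian erasures
to a word with Sturmian erasures. -/
def MSE : Set (Morphism (Fin 3)) :=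
  {f | ∀ x ∈ WSE, ∃ y, IsInfiniteImage f x y ∧ y ∈ WSE}

/-- `MSE_i`: the morphisms with Sturmian erasures that map the letter `i` to the empty word. -/
def MSEAt (i : Fin 3) : Set (Morphism (Fin 3)) :=
  {f | f ∈ MSE ∧ f (FreeMonoid.of i) = 1}

end SturmianErasures

/-!
Two words `p`, `q` *almost commute* if `pq` and `qp` differ by one transposition of adjacent distinct
letters. The whole argument rests on the following description: a binary morphism `F` maps Sturmian
words to Sturmian words if and only if `F(1)` and `F(0)` almost commute. It is proved for languages
(sets of factors) instead of words, a binary word being Sturmian when its language has exactly one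
right special word of each length (`isSturmian_iff`).

* If `p` and `q` almost commute and are not both single letters, then one of them is a prefix or a
  suffix of the other (`AlmostCommute.isPrefix_or_isSuffix`), and cutting it off leaves almost
  commuting words. So `F` is a product of elementary morphisms. These preserve the Sturmian property,
  because the right special words of `L_c(S)` are the suffixes of the words `L_c(r)c` with `r` right
  special in `S` (`IsSturmianLang.imageLang_of_almostCommute`).
* Conversely, let `F` have Sturmian images. If both values start, or both end, with the same letter,
  then, up to conjugation by a letter, an elementary morphism splits off on the left, and it also
  reflects the Sturmian property. Otherwise, both values are alternating words, and unless they are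
  letters, the images of a suitable Sturmian word have two right special words of the same length
  (`SturmianOn.almostCommute`).

Since the words over `{j, k}` obtained by erasing `i` from words with Sturmian erasures include all
Sturmian ones, a morphism `f` with `f(i) = ε` has Sturmian erasures if and only if, for each letter
`a`, the words obtained from `f(j)` and `f(k)` by erasing `a` almost commute (`mem_MSEAt_iff`). The
units among these morphisms are those that map `j` and `k` to letters up to erasures of `i`.

Now let `f = g ∘ h`. Up to erasures of `i`, either `h` maps letters to letters, and is a unit, or one
of `h(j)`, `h(k)` is a prefix or a suffix of the other one; applying `g` gives the same for `f`. This
is the first part (`isUnitMorphism_right`). If, on the other hand, `f(k) = f(j)v`, say, then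
`f = g ∘ h` with `g(j) = f(j)`, `g(k) = v`, `h(j) = ji`, `h(k) = jiki`. The erasures of `g(j)` and
`g(k)` almost commute, so `g` has Sturmian erasures. The morphism `h` is not a unit, and if `g` were
one, then `i` would occur at least as often in `f(012)` as `j` and `k` together (`not_isPrimeIn`).
-/

namespace SturmianErasures

/-! ### Almost commuting words -/

section AlmostCommute

variable {A B : Type*}

/-- Two words `p`, `q` almost commute if `pq` and `qp` differ by exactly one transposition of two
adjacent, distinct letters. -/
def AlmostCommute (p q : List A) : Prop :=
  ∃ (c d : List A) (x y : A), x ≠ y ∧ p ++ q = c ++ x :: y :: d ∧ q ++ p = c ++ y :: x :: d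

namespace AlmostCommute

variable {p q : List A}

theorem symm (h : AlmostCommute p q) : AlmostCommute q p := by
  obtain ⟨c, d, x, y, hxy, h1, h2⟩ := h
  exact ⟨c, d, y, x, hxy.symm, h2, h1⟩

theorem append_ne (h : AlmostCommute p q) : p ++ q ≠ q ++ p := by
  obtain ⟨c, d, x, y, hxy, h1, h2⟩ := h
  rw [h1, h2]
  intro h
  simp only [List.append_cancel_left_eq, List.cons.injEq] at h
  exact hxy h.1

theorem left_ne_nil (h : AlmostCommute p q) : p ≠ [] := by
  rintro rfl
  exact h.append_ne (by simp)

theorem right_ne_nil (h : AlmostCommute p q) : q ≠ [] :=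
  h.symm.left_ne_nil

theorem append_right (h : AlmostCommute p q) : AlmostCommute p (p ++ q) := by
  obtain ⟨c, d, x, y, hxy, h1, h2⟩ := h
  exact ⟨p ++ c, d, x, y, hxy, by rw [h1, List.append_assoc], by
    rw [List.append_assoc, h2, List.append_assoc]⟩

theorem append_left (h : AlmostCommute p q) : AlmostCommute p (q ++ p) := by
  obtain ⟨c, d, x, y, hxy, h1, h2⟩ := h
  exact ⟨c, d ++ p, x, y, hxy, by rw [← List.append_assoc, h1]; simp, by rw [h2]; simp⟩

/-- A common prefix of `c x …` and `c y …`, with `x ≠ y`, is a prefix of `c`. -/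
theorem _root_.List.exists_eq_append_of_append_eq_append_cons {u s t c d e : List A} {x y : A}
    (hxy : x ≠ y) (h1 : u ++ s = c ++ x :: d) (h2 : u ++ t = c ++ y :: e) :
    ∃ c', c = u ++ c' := by
  rcases List.append_eq_append_iff.1 h1 with ⟨a', rfl, _⟩ | ⟨b', rfl, hb⟩
  · exact ⟨a', rfl⟩
  · cases b' with
    | nil => exact ⟨[], by simp⟩
    | cons z b' =>
      simp only [List.append_assoc, List.append_cancel_left_eq, List.cons_append,
        List.cons.injEq] at h2 hb
      exact absurd (hb.1.trans h2.1) hxy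

theorem of_append_right (h : AlmostCommute p (p ++ q)) : AlmostCommute p q := by
  obtain ⟨c, d, x, y, hxy, h1, h2⟩ := h
  rw [List.append_assoc] at h2
  obtain ⟨c', rfl⟩ := List.exists_eq_append_of_append_eq_append_cons hxy h1 h2
  simp only [List.append_assoc, List.append_cancel_left_eq] at h1 h2
  exact ⟨c', d, x, y, hxy, h1, h2⟩

theorem reverse (h : AlmostCommute p q) : AlmostCommute p.reverse q.reverse := by
  obtain ⟨c, d, x, y, hxy, h1, h2⟩ := h
  refine ⟨d.reverse, c.reverse, x, y, hxy, ?_, ?_⟩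
  · rw [← List.reverse_append, h2]; simp
  · rw [← List.reverse_append, h1]; simp

theorem of_append_left (h : AlmostCommute p (q ++ p)) : AlmostCommute p q := by
  have h' := h.reverse
  rw [List.reverse_append] at h'
  simpa using h'.of_append_right.reverse

theorem map {e : A → B} (he : Function.Injective e) (h : AlmostCommute p q) :
    AlmostCommute (p.map e) (q.map e) := by
  obtain ⟨c, d, x, y, hxy, h1, h2⟩ := h
  exact ⟨c.map e, d.map e, e x, e y, he.ne hxy, by rw [← List.map_append, h1]; simp, by
    rw [← List.map_append, h2]; simp⟩

theorem of_map {e : A → B} (he : Function.Injective e) (h : AlmostCommute (p.map e) (q.map e)) :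
    AlmostCommute p q := by
  obtain ⟨c, d, x, y, hxy, h1, h2⟩ := h
  rw [← List.map_append] at h1 h2
  obtain ⟨c, r, h1', rfl, hr⟩ := List.map_eq_append_iff.1 h1
  obtain ⟨x, r, rfl, rfl, hr₁⟩ := List.map_eq_cons_iff.1 hr
  obtain ⟨y, d, rfl, rfl, rfl⟩ := List.map_eq_cons_iff.1 hr₁
  refine ⟨c, d, x, y, fun h => hxy (congrArg e h), h1', List.map_injective_iff.2 he ?_⟩
  rw [h2]
  simp

/-- Almost commutation is preserved when the common first letter of two words is moved to their
ends. -/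
theorem rotate {a : A} (h : AlmostCommute (a :: p) (a :: q)) :
    AlmostCommute (p ++ [a]) (q ++ [a]) := by
  obtain ⟨c, d, x, y, hxy, h1, h2⟩ := h
  cases c with
  | nil =>
    simp only [List.cons_append, List.nil_append, List.cons.injEq] at h1 h2
    exact absurd (h1.1.symm.trans h2.1) hxy
  | cons z c =>
    simp only [List.cons_append, List.cons.injEq] at h1 h2
    refine ⟨c, d ++ [a], x, y, hxy, ?_, ?_⟩
    · have := congrArg (· ++ [a]) h1.2
      simpa using this
    · have := congrArg (· ++ [a]) h2.2
      simpa using this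

/-- Unless they are single letters, the shorter one of two almost commuting words is a prefix or a
suffix of the other. -/
theorem isPrefix_or_isSuffix (h : AlmostCommute p q) (hpq : p.length ≤ q.length) :
    p <+: q ∨ p <:+ q ∨ ∃ x y, x ≠ y ∧ p = [x] ∧ q = [y] := by
  obtain ⟨c, d, x, y, hxy, h1, h2⟩ := h
  have hlen := congrArg List.length h1
  simp only [List.length_append, List.length_cons] at hlen
  by_cases hc : p.length ≤ c.length
  · left
    have hp : p <+: c := List.prefix_of_prefix_length_le (l₃ := p ++ q) ⟨q, rfl⟩ ⟨_, h1.symm⟩ hc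
    exact List.prefix_of_prefix_length_le (hp.trans ⟨_, h2.symm⟩) ⟨p, rfl⟩ hpq
  by_cases hd : p.length ≤ d.length
  · right; left
    have hp : p <:+ d := List.suffix_of_suffix_length_le (l₃ := q ++ p) ⟨q, rfl⟩
      ⟨c ++ [y, x], by rw [h2]; simp⟩ hd
    exact List.suffix_of_suffix_length_le (hp.trans ⟨c ++ [x, y], by rw [h1]; simp⟩) ⟨p, rfl⟩ hpq
  right; right
  -- Only `|c| = |d| = |p| - 1 = |q| - 1` is left, so `p = cx = xd` and `q = cy = yd`.
  have e1 : p ++ q = (c ++ [x]) ++ (y :: d) := by rw [h1]; simp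
  have e2 : q ++ p = (c ++ [y]) ++ (x :: d) := by rw [h2]; simp
  obtain ⟨p1, q1⟩ := List.append_inj e1 (by simp; omega)
  obtain ⟨q2, p2⟩ := List.append_inj e2 (by simp; omega)
  cases c with
  | nil => exact ⟨x, y, hxy, by simpa using p1, by simpa using q2⟩
  | cons z c =>
    rw [p1] at p2
    rw [q1] at q2
    simp only [List.cons_append, List.cons.injEq] at p2 q2
    exact absurd (p2.1.symm.trans q2.1.symm) hxy

end AlmostCommute

end AlmostCommute

/-! ### Languages and their right special words -/

section Languages

variable {A B C : Type*}

/-- The set of factors of the images, under the morphism with values `F` on letters, of the words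
in `S`. -/
def imageLang (F : A → List B) (S : Set (List A)) : Set (List B) :=
  {v | ∃ w ∈ S, v <:+: w.flatMap F}

/-- `S` is closed under factors, and each of its words can be extended to the right. -/
structure IsExtendable (S : Set (List A)) : Prop where
  infix_mem : ∀ {v w : List A}, w ∈ S → v <:+: w → v ∈ S
  exists_append_mem : ∀ {u : List A}, u ∈ S → ∃ e, u ++ [e] ∈ S

/-- The languages of recurrent words: in addition, any two words of `S` occur in this order,
without overlap, in a third one. -/
structure IsLanguage (S : Set (List A)) : Prop extends IsExtendable S where
  connect : ∀ {u v : List A}, u ∈ S → v ∈ S → ∃ w, u ++ w ++ v ∈ S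
  letter : ∃ e, [e] ∈ S

/-- A word `v` is right special in the binary language `S` if both `v0` and `v1` are in `S`. -/
def RightSpecial (S : Set (List Bool)) (v : List Bool) : Prop :=
  ∀ e, v ++ [e] ∈ S

/-- Exactly one word of length `n` is right special in `S`. -/
def UniqueSpecial (S : Set (List Bool)) (n : ℕ) : Prop :=
  ∃! v : List Bool, v.length = n ∧ RightSpecial S v

/-- A binary language is Sturmian if it has exactly one right special word of each length. -/
def IsSturmianLang (S : Set (List Bool)) : Prop :=
  ∀ n, UniqueSpecial S n

theorem imageLang_comp (F : A → List B) (G : B → List C) (S : Set (List A)) :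
    imageLang G (imageLang F S) = imageLang (fun a => (F a).flatMap G) S := by
  ext v
  constructor
  · rintro ⟨w, ⟨u, hu, hwu⟩, hv⟩
    exact ⟨u, hu, by simpa [List.flatMap_assoc] using hv.trans (hwu.flatMap G)⟩
  · rintro ⟨u, hu, hv⟩
    exact ⟨u.flatMap F, ⟨u, hu, List.infix_rfl⟩, by simpa [List.flatMap_assoc] using hv⟩

theorem IsExtendable.imageLang {S : Set (List A)} (h : IsExtendable S) {F : A → List B}
    (hF : ∀ a, F a ≠ []) : IsExtendable (imageLang F S) where
  infix_mem := by
    rintro v w ⟨u, hu, hw⟩ hv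
    exact ⟨u, hu, hv.trans hw⟩
  exists_append_mem := by
    rintro u ⟨w, hw, s, t, hst⟩
    obtain ⟨e, he⟩ := h.exists_append_mem hw
    obtain ⟨y, l, hy⟩ := List.exists_cons_of_ne_nil (hF e)
    rcases t with - | ⟨x, t⟩
    · exact ⟨y, _, he, s, l, by simp [← hst, hy]⟩
    · exact ⟨x, _, he, s, t ++ F e, by simp [← hst]⟩

namespace IsLanguage

variable {S : Set (List A)}

theorem imageLang (h : IsLanguage S) {F : A → List B} (hF : ∀ a, F a ≠ []) :
    IsLanguage (imageLang F S) where
  toIsExtendable := h.toIsExtendable.imageLang hF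
  connect := by
    rintro u v ⟨u', hu', s, t, hst⟩ ⟨v', hv', s', t', hst'⟩
    obtain ⟨w, hw⟩ := h.connect hu' hv'
    refine ⟨t ++ w.flatMap F ++ s', _, hw, s, t', ?_⟩
    simp only [List.flatMap_append, ← hst, ← hst', List.append_assoc]
  letter := by
    obtain ⟨e, he⟩ := h.letter
    obtain ⟨x, l, hx⟩ := List.exists_cons_of_ne_nil (hF e)
    exact ⟨x, [e], he, [], l, by simp [hx]⟩

theorem exists_cons_mem (h : IsLanguage S) {u : List A} (hu : u ∈ S) : ∃ e, e :: u ∈ S := by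
  obtain ⟨e, he⟩ := h.letter
  obtain ⟨w, hw⟩ := h.connect he hu
  rcases List.eq_nil_or_concat' w with rfl | ⟨w, x, rfl⟩
  · exact ⟨e, by simpa using hw⟩
  · exact ⟨x, h.infix_mem hw ⟨e :: w, [], by simp⟩⟩

/-- Conjugating a morphism by a letter does not change the image of a language. -/
theorem imageLang_rotate (h : IsLanguage S) {F : A → List B} {a : B} :
    SturmianErasures.imageLang (fun e => a :: F e) S =
      SturmianErasures.imageLang (fun e => F e ++ [a]) S := by
  have key : ∀ w : List A, w.flatMap (fun e => a :: F e) ++ [a] =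
      a :: w.flatMap (fun e => F e ++ [a]) := by
    intro w
    induction w with
    | nil => rfl
    | cons x w ih => simp [ih]
  ext v
  constructor
  · rintro ⟨w, hw, hv⟩
    obtain ⟨e, he⟩ := h.exists_cons_mem hw
    refine ⟨e :: w, he, hv.trans ⟨F e, [a], ?_⟩⟩
    rw [List.append_assoc, key]
    simp
  · rintro ⟨w, hw, hv⟩
    obtain ⟨e, he⟩ := h.exists_append_mem hw
    refine ⟨w ++ [e], he, hv.trans ⟨[a], F e, ?_⟩⟩
    rw [List.singleton_append, ← key]
    simp

end IsLanguage

namespace RightSpecial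

variable {S : Set (List Bool)} {u v : List Bool}

theorem of_suffix (hS : IsExtendable S) (hv : RightSpecial S v) (h : u <:+ v) :
    RightSpecial S u := by
  obtain ⟨t, rfl⟩ := h
  exact fun e => hS.infix_mem (hv e) ⟨t, [], by simp⟩

theorem exists_suffix {n : ℕ} (hS : IsExtendable S) (hv : RightSpecial S v) (h : n ≤ v.length) :
    ∃ u, u <:+ v ∧ u.length = n ∧ RightSpecial S u :=
  ⟨v.drop (v.length - n), List.drop_suffix _ _, by simp; omega,
    hv.of_suffix hS (List.drop_suffix _ _)⟩

/-- Where right special words are unique, they form a chain under the suffix order. -/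
theorem suffix_of_unique {n : ℕ} (hS : IsExtendable S) (hn : UniqueSpecial S n)
    (hu : RightSpecial S u) (hv : RightSpecial S v) (hun : u.length = n) (hnv : n ≤ v.length) :
    u <:+ v := by
  obtain ⟨u', hu', hlen, hsp⟩ := hv.exists_suffix hS hnv
  rwa [hn.unique ⟨hun, hu⟩ ⟨hlen, hsp⟩]

end RightSpecial

theorem IsSturmianLang.letter_mem {S : Set (List Bool)} (h : IsSturmianLang S) (e : Bool) :
    [e] ∈ S := by
  obtain ⟨v, ⟨hv, hsp⟩, _⟩ := h 0
  rw [List.length_eq_zero_iff.1 hv] at hsp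
  exact hsp e

end Languages

/-! ### The elementary morphism `c ↦ c`, `e ↦ ce` -/

section Elementary

/-- The elementary Sturmian morphism `L_c` of a two letter alphabet: it fixes the letter `c` and
maps the other letter `e` to `ce`. -/
def lmor (c : Bool) (e : Bool) : List Bool :=
  if e = c then [c] else [c, e]

@[simp] theorem lmor_self (c : Bool) : lmor c c = [c] := by simp [lmor]

@[simp] theorem lmor_not (c : Bool) : lmor c (!c) = [c, !c] := by simp [lmor]

theorem lmor_ne_nil (c e : Bool) : lmor c e ≠ [] := by
  unfold lmor; split <;> simp

variable {c : Bool}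

/-- Cutting `L_c(w)` before a letter `c` cuts `w`. -/
theorem exists_of_flatMap_lmor_eq {w X Z : List Bool} (h : w.flatMap (lmor c) = X ++ c :: Z) :
    ∃ w₁ w₂, w = w₁ ++ w₂ ∧ w₁.flatMap (lmor c) = X ∧ w₂.flatMap (lmor c) = c :: Z := by
  induction w generalizing X with
  | nil => simp at h
  | cons x w ih =>
    cases X with
    | nil => exact ⟨[], x :: w, rfl, rfl, h⟩
    | cons y X =>
      obtain rfl | hx := Bool.eq_or_eq_not x c
      · simp only [List.flatMap_cons, lmor_self, List.cons_append, List.nil_append,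
          List.cons.injEq] at h
        obtain ⟨w₁, w₂, rfl, h1, h2⟩ := ih h.2
        exact ⟨x :: w₁, w₂, rfl, by simp only [List.flatMap_cons, lmor_self, h1, ← h.1]; rfl, h2⟩
      · subst hx
        cases X with
        | nil => simp at h
        | cons z X =>
          simp only [List.flatMap_cons, lmor_not, List.cons_append, List.nil_append,
            List.cons.injEq] at h
          obtain ⟨w₁, w₂, rfl, h1, h2⟩ := ih h.2.2
          exact ⟨(!c) :: w₁, w₂, rfl, by
            simp only [List.flatMap_cons, lmor_not, h1, ← h.1, ← h.2.1]; rfl, h2⟩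

theorem exists_flatMap_lmor_eq_cons {w : List Bool} (hw : w ≠ []) :
    ∃ l, w.flatMap (lmor c) = c :: l := by
  obtain ⟨x, w, rfl⟩ := List.exists_cons_of_ne_nil hw
  obtain rfl | rfl := Bool.eq_or_eq_not x c
  · exact ⟨_, by simp; rfl⟩
  · exact ⟨(!c) :: w.flatMap (lmor c), by simp⟩

theorem flatMap_lmor_ne_not_cons {w l : List Bool} : w.flatMap (lmor c) ≠ (!c) :: l := by
  intro h
  rcases eq_or_ne w [] with rfl | hw
  · simp at h
  · obtain ⟨l', hl⟩ := exists_flatMap_lmor_eq_cons (c := c) hw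
    simp [hl] at h

theorem flatMap_lmor_injective : Function.Injective fun w : List Bool => w.flatMap (lmor c) := by
  intro u v h
  induction u generalizing v with
  | nil =>
    rcases eq_or_ne v [] with rfl | hv
    · rfl
    · obtain ⟨l, hl⟩ := exists_flatMap_lmor_eq_cons (c := c) hv
      simp only [hl, List.flatMap_nil] at h
      exact absurd h (by simp)
  | cons x u ih =>
    cases v with
    | nil =>
      obtain ⟨l, hl⟩ := exists_flatMap_lmor_eq_cons (c := c) (List.cons_ne_nil x u)
      simp only [hl, List.flatMap_nil] at h
      exact absurd h (by simp)
    | cons y v =>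
      obtain hx | hx := Bool.eq_or_eq_not x c <;> obtain hy | hy := Bool.eq_or_eq_not y c <;>
        rw [hx, hy] at h ⊢ <;> simp only [List.flatMap_cons, lmor_self, lmor_not, List.cons_append,
          List.nil_append, List.cons.injEq, true_and] at h
      · rw [ih h]
      · exact absurd h flatMap_lmor_ne_not_cons
      · exact absurd h.symm flatMap_lmor_ne_not_cons
      · rw [ih h]

theorem not_infix_flatMap_lmor (w : List Bool) : ¬ [!c, !c] <:+: w.flatMap (lmor c) := by
  induction w with
  | nil => simp
  | cons x w ih =>
    obtain rfl | rfl := Bool.eq_or_eq_not x c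
    · simpa [List.infix_cons_iff] using ih
    · simp only [List.flatMap_cons, lmor_not, List.cons_append, List.nil_append,
        List.infix_cons_iff, List.cons_prefix_cons, ih, or_false]
      rintro (⟨h, -⟩ | ⟨-, l, hl⟩)
      · simp at h
      · exact flatMap_lmor_ne_not_cons hl.symm

theorem exists_of_flatMap_lmor_eq_append_not {w X : List Bool}
    (h : w.flatMap (lmor c) = X ++ [!c]) : ∃ u, w = u ++ [!c] := by
  rcases List.eq_nil_or_concat' w with rfl | ⟨u, x, rfl⟩
  · simp at h
  · obtain rfl | rfl := Bool.eq_or_eq_not x c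
    · have := congrArg List.getLast? h
      simp at this
    · exact ⟨u, rfl⟩

theorem isSuffix_of_flatMap_lmor {u v : List Bool}
    (h : u.flatMap (lmor c) <:+ v.flatMap (lmor c)) : u <:+ v := by
  rcases eq_or_ne u [] with rfl | hu
  · exact List.nil_suffix
  obtain ⟨X, hX⟩ := h
  obtain ⟨l, hl⟩ := exists_flatMap_lmor_eq_cons (c := c) hu
  rw [hl] at hX
  obtain ⟨v₁, v₂, rfl, -, h2⟩ := exists_of_flatMap_lmor_eq hX.symm
  rw [← hl] at h2
  rw [flatMap_lmor_injective h2]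
  exact List.suffix_append _ _

theorem length_le_length_flatMap_lmor (w : List Bool) : w.length ≤ (w.flatMap (lmor c)).length := by
  induction w with
  | nil => simp
  | cons x w ih =>
    have := List.length_pos_of_ne_nil (lmor_ne_nil c x)
    simp only [List.length_cons, List.flatMap_cons, List.length_append]
    omega

theorem length_flatMap_lmor_le (w : List Bool) : (w.flatMap (lmor c)).length ≤ 2 * w.length := by
  induction w with
  | nil => simp
  | cons x w ih =>
    have : (lmor c x).length ≤ 2 := by unfold lmor; split <;> simp
    simp only [List.length_cons, List.flatMap_cons, List.length_append]
    omega

/-- If `L_c(w)ce` is a factor of `L_c(W)`, then `we` is a factor of `W`. -/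
theorem infix_of_append_lmor {w W X Y : List Bool} {e : Bool}
    (h : W.flatMap (lmor c) = X ++ (w.flatMap (lmor c) ++ [c, e]) ++ Y) :
    ∃ W₁ W₂ Z, W = W₁ ++ W₂ ∧ W₁.flatMap (lmor c) = X ∧ W₂ = w ++ e :: Z := by
  obtain ⟨l, hl⟩ : ∃ l, w.flatMap (lmor c) ++ [c, e] ++ Y = c :: l := by
    rcases eq_or_ne w [] with rfl | hw
    · exact ⟨e :: Y, by simp⟩
    · obtain ⟨l, hl⟩ := exists_flatMap_lmor_eq_cons (c := c) hw
      exact ⟨l ++ [c, e] ++ Y, by rw [hl]; simp⟩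
  rw [List.append_assoc, hl] at h
  obtain ⟨W₁, W₂, rfl, h1, h2⟩ := exists_of_flatMap_lmor_eq h
  refine ⟨W₁, W₂, ?_⟩
  rw [← hl, List.append_assoc, List.cons_append] at h2
  obtain ⟨W₃, W₄, rfl, h3, h4⟩ := exists_of_flatMap_lmor_eq h2
  obtain rfl := flatMap_lmor_injective h3
  cases W₄ with
  | nil => simp at h4
  | cons x Z =>
    refine ⟨Z, rfl, h1, ?_⟩
    obtain rfl | rfl := Bool.eq_or_eq_not x c
    · simp only [List.flatMap_cons, lmor_self, List.cons_append, List.nil_append, List.cons.injEq, true_and] at h4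
      obtain rfl | rfl := Bool.eq_or_eq_not e x
      · rfl
      · exact absurd h4 flatMap_lmor_ne_not_cons
    · simp only [List.flatMap_cons, lmor_not, List.cons_append,
        List.nil_append, List.cons.injEq, true_and] at h4
      rw [h4.1]

variable {S : Set (List Bool)}

theorem append_mem_of_flatMap_lmor (hS : IsExtendable S) {w : List Bool} {e : Bool}
    (h : w.flatMap (lmor c) ++ [c, e] ∈ imageLang (lmor c) S) : w ++ [e] ∈ S := by
  obtain ⟨W, hW, X, Y, hXY⟩ := h
  obtain ⟨W₁, W₂, Z, rfl, -, rfl⟩ := infix_of_append_lmor hXY.symm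
  exact hS.infix_mem hW ⟨W₁, Z, by simp⟩

theorem not_append_mem_of_flatMap_lmor (hS : IsExtendable S) {w : List Bool} {e : Bool}
    (h : (!c) :: w.flatMap (lmor c) ++ [c, e] ∈ imageLang (lmor c) S) :
    (!c) :: w ++ [e] ∈ S := by
  obtain ⟨W, hW, X, Y, hXY⟩ := h
  obtain ⟨W₁, W₂, Z, rfl, h1, rfl⟩ := infix_of_append_lmor (c := c) (W := W) (X := X ++ [!c])
    (w := w) (e := e) (Y := Y) (by rw [← hXY]; simp)
  obtain ⟨u, rfl⟩ := exists_of_flatMap_lmor_eq_append_not h1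
  exact hS.infix_mem hW ⟨u, Z, by simp⟩

/-- A right special word `r` of `S` gives the right special word `L_c(r)c` of `L_c(S)`. -/
theorem RightSpecial.lmor (hS : IsExtendable S) {r : List Bool} (hr : RightSpecial S r) :
    RightSpecial (imageLang (lmor c) S) (r.flatMap (lmor c) ++ [c]) := by
  intro e
  obtain rfl | rfl := Bool.eq_or_eq_not e c
  · obtain ⟨x, hx⟩ := hS.exists_append_mem (hr e)
    refine ⟨_, hx, ?_⟩
    obtain ⟨l, hl⟩ : ∃ l, SturmianErasures.lmor e x = e :: l := by
      unfold SturmianErasures.lmor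
      split <;> exact ⟨_, rfl⟩
    exact ⟨[], l, by simp [hl]⟩
  · exact ⟨_, hr (!c), [], [], by simp⟩

/-- All right special words of `L_c(S)` come from right special words of `S`. -/
theorem RightSpecial.exists_of_lmor (hS : IsExtendable S) {v : List Bool} (hv : v ≠ [])
    (h : RightSpecial (imageLang (SturmianErasures.lmor c) S) v) :
    ∃ r, RightSpecial S r ∧ r.length < v.length ∧
      v <:+ r.flatMap (SturmianErasures.lmor c) ++ [c] := by
  obtain ⟨v, x, rfl⟩ := (List.eq_nil_or_concat' v).resolve_left hv
  obtain ⟨W, hW, X, Y, hXY⟩ := h (!c)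
  -- The letter `!c` is never doubled in `L_c(S)`.
  obtain rfl | rfl := Bool.eq_or_eq_not x c
  swap
  · exact absurd ⟨X ++ v, Y, by rw [← hXY]; simp⟩ (not_infix_flatMap_lmor (c := c) W)
  · have hXY' : W.flatMap (SturmianErasures.lmor x) = (X ++ v) ++ x :: ((!x) :: Y) := by
      rw [← hXY]; simp
    obtain ⟨W₁, -, -, h1, -⟩ := exists_of_flatMap_lmor_eq hXY'
    -- Either `v = L_c(w)` or `v = !c L_c(w)`.
    rcases v with - | ⟨y, v⟩
    · refine ⟨[], fun e => append_mem_of_flatMap_lmor (c := x) hS (by simpa using h e), ?_, ?_⟩ <;>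
        simp
    obtain rfl | rfl := Bool.eq_or_eq_not y x
    · obtain ⟨-, w, -, -, h2⟩ := exists_of_flatMap_lmor_eq h1
      refine ⟨w, fun e => append_mem_of_flatMap_lmor (c := y) hS ?_, ?_, ?_⟩
      · rw [h2]; simpa using h e
      · have := length_le_length_flatMap_lmor (c := y) w
        rw [h2] at this
        simp at this ⊢
        omega
      · rw [h2]
    · obtain ⟨w, hw⟩ : ∃ w : List Bool, w.flatMap (SturmianErasures.lmor x) = v := by
        rcases v with - | ⟨z, v⟩
        · exact ⟨[], rfl⟩
        obtain rfl | rfl := Bool.eq_or_eq_not z x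
        · rw [show X ++ (!z) :: z :: v = (X ++ [!z]) ++ z :: v by simp] at h1
          obtain ⟨-, w, -, -, h2⟩ := exists_of_flatMap_lmor_eq h1
          exact ⟨w, h2⟩
        · exact absurd ⟨X, v ++ (x :: (!x) :: Y), by rw [← hXY]; simp⟩
            (not_infix_flatMap_lmor (c := x) W)
      refine ⟨(!x) :: w, fun e => not_append_mem_of_flatMap_lmor (c := x) hS ?_, ?_, ?_⟩
      · rw [hw]; simpa using h e
      · have := length_le_length_flatMap_lmor (c := x) w
        rw [hw] at this
        simp at this ⊢
        omega
      · rw [← hw]; exact ⟨[x], by simp⟩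

/-- If right special words are unique up to length `n` in `S`, then they are unique up to length
`n + 1` in `L_c(S)`. -/
theorem UniqueSpecial.imageLang_lmor (hS : IsExtendable S) {n : ℕ}
    (h : ∀ m ≤ n, UniqueSpecial S m) {m : ℕ} (hm : m ≤ n + 1) :
    UniqueSpecial (imageLang (lmor c) S) m := by
  have hS' : IsExtendable (imageLang (lmor c) S) := hS.imageLang (lmor_ne_nil c)
  obtain ⟨r, ⟨hrn, hr⟩, -⟩ := h n le_rfl
  have hlen := length_le_length_flatMap_lmor (c := c) r
  obtain ⟨u, -, hum, hu⟩ := (hr.lmor (c := c) hS).exists_suffix (n := m) hS'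
    (by rw [List.length_append, List.length_singleton]; omega)
  refine ⟨u, ⟨hum, hu⟩, ?_⟩
  have key : ∀ {v v' r r' : List Bool}, v <:+ r.flatMap (lmor c) ++ [c] →
      v' <:+ r'.flatMap (lmor c) ++ [c] → r <:+ r' → v.length = v'.length → v' = v := by
    rintro v v' r r' hv hv' ⟨t, rfl⟩ hlen
    have hv : v <:+ (t ++ r).flatMap (lmor c) ++ [c] :=
      hv.trans ⟨t.flatMap (lmor c), by simp⟩
    exact (List.suffix_of_suffix_length_le hv' hv hlen.ge).eq_of_length hlen.symm
  rintro v ⟨hvm, hv⟩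
  rcases eq_or_ne m 0 with rfl | hm0
  · rw [List.length_eq_zero_iff.1 hvm, List.length_eq_zero_iff.1 hum]
  obtain ⟨r, hr, hrl, hur⟩ := hu.exists_of_lmor hS (by rintro rfl; simp at hum; omega)
  obtain ⟨r', hr', hrl', hvr⟩ := hv.exists_of_lmor hS (by rintro rfl; simp at hvm; omega)
  rcases le_total r.length r'.length with hle | hle
  · exact key hur hvr (hr.suffix_of_unique hS (h _ (by omega)) hr' rfl hle) (by omega)
  · exact (key hvr hur (hr'.suffix_of_unique hS (h _ (by omega)) hr rfl hle) (by omega)).symm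

/-- The morphism `L_c` preserves and reflects the Sturmian property of languages. -/
theorem isSturmianLang_imageLang_lmor (hS : IsExtendable S) :
    IsSturmianLang (imageLang (lmor c) S) ↔ IsSturmianLang S := by
  refine ⟨fun h n => ?_, fun h n => UniqueSpecial.imageLang_lmor hS (fun m _ => h m) n.le_succ⟩
  have hS' : IsExtendable (imageLang (lmor c) S) := hS.imageLang (lmor_ne_nil c)
  obtain ⟨v, ⟨hvn, hv⟩, -⟩ := h (2 * n + 1)
  obtain ⟨r, hr, -, hvr⟩ := hv.exists_of_lmor hS (by rintro rfl; simp at hvn)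
  have h1 := hvr.length_le
  have h2 := length_flatMap_lmor_le (c := c) r
  simp only [List.length_append, List.length_singleton] at h1
  obtain ⟨u, -, hun, hu⟩ := hr.exists_suffix (n := n) hS (by omega)
  refine ⟨u, ⟨hun, hu⟩, fun u' ⟨hun', hu'⟩ => ?_⟩
  have key : ∀ {u u' : List Bool}, RightSpecial S u → RightSpecial S u' →
      (u.flatMap (lmor c)).length ≤ (u'.flatMap (lmor c)).length → u <:+ u' := by
    intro u u' hu hu' hle
    have := (hu.lmor (c := c) hS).suffix_of_unique hS' (h _) (hu'.lmor (c := c) hS) rfl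
      (by simpa using hle)
    refine isSuffix_of_flatMap_lmor (c := c) ?_
    simpa [List.suffix_append_self_iff] using this
  rcases le_total (u.flatMap (lmor c)).length (u'.flatMap (lmor c)).length with hle | hle
  · exact ((key hu hu' hle).eq_of_length (by omega)).symm
  · exact (key hu' hu hle).eq_of_length (by omega)

end Elementary

/-! ### Binary morphisms that preserve Sturmian languages -/

section Preserve

variable {S : Set (List Bool)}

theorem _root_.List.flatMap_singleton_eq_map {A B : Type*} (f : A → B) (l : List A) :
    l.flatMap (fun a => [f a]) = l.map f := by
  induction l with
  | nil => rfl
  | cons a l ih => simp [ih]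

theorem IsLanguage.imageLang_singleton {A : Type*} {S : Set (List A)} (hS : IsLanguage S) :
    SturmianErasures.imageLang (fun a => [a]) S = S := by
  ext v
  refine ⟨?_, fun h => ⟨v, h, by simp⟩⟩
  rintro ⟨w, hw, hv⟩
  exact hS.infix_mem hw (by simpa using hv)

theorem map_not_map_not (l : List Bool) : (l.map not).map not = l := by
  induction l with
  | nil => rfl
  | cons x l ih => simpa using ih

theorem mem_imageLang_not (hS : IsExtendable S) {v : List Bool} :
    v ∈ imageLang (fun e => [!e]) S ↔ v.map not ∈ S := by
  have hnot := map_not_map_not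
  constructor
  · rintro ⟨w, hw, hv⟩
    rw [List.flatMap_singleton_eq_map] at hv
    refine hS.infix_mem hw ?_
    simpa [hnot] using hv.map not
  · intro h
    exact ⟨_, h, by rw [List.flatMap_singleton_eq_map, hnot]⟩

theorem UniqueSpecial.imageLang_not (hS : IsExtendable S) {n : ℕ} (h : UniqueSpecial S n) :
    UniqueSpecial (imageLang (fun e => [!e]) S) n := by
  have hsp : ∀ {v : List Bool}, RightSpecial (imageLang (fun e => [!e]) S) v ↔
      RightSpecial S (v.map not) := by
    intro v
    simp only [RightSpecial, mem_imageLang_not hS, List.map_append, List.map_cons, List.map_nil]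
    exact ⟨fun h e => by simpa using h (!e), fun h e => h (!e)⟩
  obtain ⟨v, ⟨hvn, hv⟩, huniq⟩ := h
  refine ⟨v.map not, ⟨by simpa using hvn, hsp.2 (by rwa [map_not_map_not])⟩, fun u ⟨hun, hu⟩ => ?_⟩
  rw [← huniq (u.map not) ⟨by simpa using hun, hsp.1 hu⟩, map_not_map_not]

/-- A morphism whose two values almost commute preserves Sturmian languages: as one of the values
is a prefix or a suffix of the other one, an elementary morphism can be split off on the right. -/
theorem IsSturmianLang.imageLang_of_almostCommute {F : Bool → List Bool}
    (hF : AlmostCommute (F true) (F false)) (hS : IsLanguage S) (h : IsSturmianLang S) :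
    IsSturmianLang (imageLang F S) := by
  induction hn : (F true).length + (F false).length using Nat.strong_induction_on
    generalizing F S with
  | _ n ih =>
  obtain ⟨c, hc⟩ : ∃ c, (F c).length ≤ (F !c).length := by
    rcases le_total (F true).length (F false).length with h | h
    exacts [⟨true, h⟩, ⟨false, h⟩]
  have hFc : AlmostCommute (F c) (F !c) := by
    cases c
    exacts [hF.symm, hF]
  have hpos := List.length_pos_of_ne_nil hFc.left_ne_nil
  have hsum : (F c).length + (F !c).length = n := by
    rw [← hn]
    cases c
    exacts [add_comm _ _, rfl]
  have step : ∀ v : List Bool, AlmostCommute (F c) v → (F !c).length = (F c).length + v.length →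
      IsSturmianLang (imageLang (fun e => if e = c then F c else v) (imageLang (lmor c) S)) := by
    intro v hv hlen
    refine ih ((F c).length + v.length) (by omega) ?_ (hS.imageLang (lmor_ne_nil c))
      ((isSturmianLang_imageLang_lmor hS.toIsExtendable).2 h) ?_ <;> cases c
    · simpa using hv.symm
    · simpa using hv
    · simp [add_comm]
    · simp
  rcases hFc.isPrefix_or_isSuffix hc with ⟨v, hv⟩ | ⟨v, hv⟩ | ⟨x, y, hxy, hx, hy⟩
  · rw [← hv] at hFc
    convert step v hFc.of_append_right (by rw [← hv]; simp) using 1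
    rw [imageLang_comp]
    congr 1
    funext e
    obtain rfl | rfl := Bool.eq_or_eq_not e c
    · simp
    · simp [hv]
  · rw [← hv] at hFc
    convert step v hFc.of_append_left (by rw [← hv]; simp [add_comm]) using 1
    -- The morphisms `c ↦ c, e ↦ ce` and `c ↦ c, e ↦ ec` are conjugate by `c`.
    have hrot := hS.imageLang_rotate (F := fun e : Bool => if e = c then [] else [e]) (a := c)
    have hl : (fun e : Bool => c :: if e = c then [] else [e]) = lmor c := by
      funext e
      unfold lmor
      split <;> rfl
    rw [hl] at hrot
    rw [hrot, imageLang_comp]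
    congr 1
    funext e
    obtain rfl | rfl := Bool.eq_or_eq_not e c
    · simp
    · simp [hv]
  · obtain rfl | rfl := Bool.eq_or_eq_not x c
    · obtain rfl : y = !x := (Bool.eq_not_of_ne hxy.symm)
      have : F = fun e => [e] := by
        funext e
        obtain rfl | rfl := Bool.eq_or_eq_not e x
        exacts [hx, hy]
      rwa [this, hS.imageLang_singleton]
    · obtain rfl : y = c := by simpa using (Bool.eq_not_of_ne hxy.symm)
      have : F = fun e => [!e] := by
        funext e
        obtain rfl | rfl := Bool.eq_or_eq_not e y
        · exact hx
        · simpa using hy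
      rw [this]
      exact fun n => (h n).imageLang_not hS.toIsExtendable

end Preserve

/-! ### Morphisms with Sturmian images -/

section Reflect

variable {S : Set (List Bool)}

theorem _root_.List.pair_infix_of_cons_append (e : Bool) (w : List Bool) :
    [e, !e] <:+: e :: w ++ [!e] := by
  induction w with
  | nil => exact List.infix_rfl
  | cons x w ih =>
    obtain rfl | rfl := Bool.eq_or_eq_not x e
    · exact List.infix_cons ih
    · exact ⟨[], w ++ [!e], by simp⟩

theorem IsSturmianLang.pair_mem (h : IsSturmianLang S) (hS : IsLanguage S) (e : Bool) :
    [e, !e] ∈ S := by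
  obtain ⟨w, hw⟩ := hS.connect (h.letter_mem e) (h.letter_mem !e)
  exact hS.infix_mem hw (List.pair_infix_of_cons_append e w)

theorem IsSturmianLang.not_square (h : IsSturmianLang S) (hS : IsLanguage S) {e : Bool}
    (h1 : [e, e] ∈ S) : [!e, !e] ∉ S := by
  intro h2
  have he : RightSpecial S [e] := by
    intro x
    obtain rfl | rfl := Bool.eq_or_eq_not x e
    exacts [h1, h.pair_mem hS e]
  have hn : RightSpecial S [!e] := by
    intro x
    obtain rfl | rfl := Bool.eq_or_eq_not x e
    · simpa using h.pair_mem hS (!x)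
    · exact h2
  have := (h 1).unique ⟨rfl, he⟩ ⟨rfl, hn⟩
  simp at this

/-- A morphism erasing a letter has periodic images, so they are not Sturmian. -/
theorem IsSturmianLang.ne_nil {F : Bool → List Bool} (h : IsSturmianLang (imageLang F S))
    (e : Bool) : F e ≠ [] := by
  intro he
  have hcomm : ∀ u : List Bool, u.flatMap F ++ F (!e) = F (!e) ++ u.flatMap F := by
    intro u
    induction u with
    | nil => simp
    | cons x u ih =>
      obtain rfl | rfl := Bool.eq_or_eq_not x e
      · simpa [he] using ih
      · simp [ih]
  obtain ⟨v, ⟨hvn, hv⟩, -⟩ := h (F !e).length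
  have hlast : ∀ x, v.head? = some x := by
    intro x
    obtain ⟨u, -, X, Y, hXY⟩ := hv x
    rcases v with - | ⟨y, v⟩
    · have hnil : F (!e) = [] := List.length_eq_zero_iff.1 hvn.symm
      have : u.flatMap F = [] := by
        rw [List.flatMap_eq_nil_iff]
        intro z _
        obtain rfl | rfl := Bool.eq_or_eq_not z e
        exacts [he, hnil]
      simp [this] at hXY
    · have h1 := congrArg (fun l : List Bool => l[X.length + (F !e).length]?) (hcomm u)
      rw [← hXY] at h1
      rw [← hvn] at h1
      simp only [List.append_assoc] at h1
      rw [List.getElem?_append_right (l₁ := X) (by omega),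
        List.getElem?_append_right (l₁ := F !e) (by omega)] at h1
      have e1 : X.length + (y :: v).length - X.length = (y :: v).length := by omega
      have e2 : X.length + (y :: v).length - (F !e).length = X.length := by omega
      rw [e1, e2] at h1
      simp at h1
      simp [h1]
  have := (hlast true).symm.trans (hlast false)
  simp at this

theorem length_flatMap_lmor {c : Bool} (w : List Bool) :
    (w.flatMap (lmor c)).length = w.length + w.count (!c) := by
  induction w with
  | nil => simp
  | cons x w ih =>
    simp only [List.flatMap_cons, List.length_append, ih, List.length_cons]
    obtain rfl | rfl := Bool.eq_or_eq_not x c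
    · simp; omega
    · simp; omega

/-- A word that starts with `c` and does not contain the square of the other letter is an image
under `L_c`. -/
theorem exists_eq_flatMap_lmor {c : Bool} {w : List Bool} (hw : ∀ l, w ≠ (!c) :: l)
    (h : ¬ [!c, !c] <:+: w) : ∃ u : List Bool, w = u.flatMap (lmor c) := by
  induction hn : w.length using Nat.strong_induction_on generalizing w with
  | _ n ih =>
  rcases w with - | ⟨x, w⟩
  · exact ⟨[], rfl⟩
  obtain rfl : x = c := by
    obtain rfl | rfl := Bool.eq_or_eq_not x c
    exacts [rfl, absurd rfl (hw w)]
  by_cases hw' : ∃ l, w = (!x) :: l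
  · obtain ⟨l, rfl⟩ := hw'
    obtain ⟨u, rfl⟩ := ih l.length (by simp at hn; omega) (w := l)
      (by rintro l rfl; exact h ⟨[x], l, by simp⟩)
      (fun h' => h (h'.trans ⟨[x, !x], [], by simp⟩)) rfl
    exact ⟨(!x) :: u, by simp⟩
  · obtain ⟨u, rfl⟩ := ih w.length (by simp at hn; omega) (w := w)
      (fun l hl => hw' ⟨l, hl⟩) (fun h' => h (h'.trans ⟨[x], [], by simp⟩)) rfl
    exact ⟨x :: u, by simp⟩

/-- The alternating word of length `n` that starts with `a`. -/
def altWord : Bool → ℕ → List Bool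
  | _, 0 => []
  | a, n + 1 => a :: altWord (!a) n

theorem eq_altWord {a : Bool} {l : List Bool} (h : (a :: l).IsChain (· ≠ ·)) :
    a :: l = altWord a (l.length + 1) := by
  induction l generalizing a with
  | nil => rfl
  | cons x l ih =>
    rw [List.isChain_cons_cons] at h
    obtain rfl : x = !a := Bool.eq_not_of_ne h.1.symm
    exact congrArg (a :: ·) (ih h.2)

theorem altWord_prefix (a : Bool) {m n : ℕ} (h : m ≤ n) : altWord a m <+: altWord a n := by
  induction m generalizing a n with
  | zero => exact List.nil_prefix
  | succ m ih =>
    obtain ⟨n, rfl⟩ : ∃ k, n = k + 1 := ⟨n - 1, by omega⟩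
    simpa [altWord, List.cons_prefix_cons] using ih (!a) (by omega : m ≤ n)

theorem isChain_ne_of_not_infix {w : List Bool} (h : ∀ x, ¬ [x, x] <:+: w) :
    w.IsChain (· ≠ ·) := by
  induction w with
  | nil => exact List.isChain_nil
  | cons x w ih =>
    have hw := ih fun y hy => h y (List.infix_cons hy)
    rcases w with - | ⟨y, w⟩
    · exact List.isChain_singleton x
    · refine List.isChain_cons_cons.2 ⟨?_, hw⟩
      rintro rfl
      exact h x ⟨[], w, by simp⟩

theorem AlmostCommute.flatMap_lmor {c : Bool} {p q : List Bool} (h : AlmostCommute p q) :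
    AlmostCommute (p.flatMap (lmor c)) (q.flatMap (lmor c)) := by
  obtain ⟨u, v, x, y, hxy, h1, h2⟩ := h
  rw [AlmostCommute, ← List.flatMap_append, ← List.flatMap_append, h1, h2]
  obtain rfl | rfl := Bool.eq_or_eq_not x c
  · obtain rfl : y = !x := Bool.eq_not_of_ne hxy.symm
    exact ⟨u.flatMap (lmor x) ++ [x], v.flatMap (lmor x), x, !x, hxy, by simp, by simp⟩
  · obtain rfl : y = c := by simpa using Bool.eq_not_of_ne hxy.symm
    exact ⟨u.flatMap (lmor y) ++ [y], v.flatMap (lmor y), !y, y, hxy, by simp, by simp⟩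

variable {T : Bool → Set (List Bool)} {F : Bool → List Bool}

/-- The set of morphisms that map all languages `T c` to Sturmian languages. -/
def SturmianOn (T : Bool → Set (List Bool)) (F : Bool → List Bool) : Prop :=
  ∀ c, IsSturmianLang (imageLang F (T c))

/-- If both values of `F` start with `a` and the square of the other letter does not occur, then
`L_a` splits off on the left. -/
theorem SturmianOn.exists_lmor (hT : ∀ c, IsLanguage (T c)) (h : SturmianOn T F) {a : Bool}
    {v : Bool → List Bool} (hF : ∀ e, F e = a :: v e) (hsq : ∀ e, ¬ [!a, !a] <:+: F e) :
    ∃ G : Bool → List Bool, SturmianOn T G ∧ (∀ e, F e = (G e).flatMap (lmor a)) ∧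
      (G true).length + (G false).length < (F true).length + (F false).length := by
  have hex : ∀ e, ∃ u : List Bool, F e = u.flatMap (lmor a) := fun e =>
    exists_eq_flatMap_lmor (by intro l hl; rw [hF] at hl; simp at hl) (hsq e)
  choose G hG using hex
  have hGF : F = fun e => (G e).flatMap (lmor a) := funext hG
  have hne : ∀ e, G e ≠ [] := by
    intro e he
    have := hG e
    rw [he, hF] at this
    simp at this
  refine ⟨G, fun c => ?_, hG, ?_⟩
  · have hc := h c
    rw [hGF, ← imageLang_comp] at hc
    exact (isSturmianLang_imageLang_lmor ((hT c).imageLang hne).toIsExtendable).1 hc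
  · -- The letter `!a` occurs in the images, and each of its occurrences makes `G` shorter.
    obtain ⟨w, -, hw⟩ := (h true).letter_mem (!a)
    have hmem := hw.subset (List.mem_singleton_self _)
    obtain ⟨e, -, he⟩ := List.mem_flatMap.1 hmem
    rw [hG e] at he
    obtain ⟨x, hx, hax⟩ := List.mem_flatMap.1 he
    obtain rfl | rfl := Bool.eq_or_eq_not x a
    · simp at hax
    have hpos := List.count_pos_iff.2 hx
    rw [hG true, hG false, length_flatMap_lmor, length_flatMap_lmor]
    cases e <;> omega

/-- Conjugation of `F` by a letter preserves `SturmianOn T F`. -/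
theorem SturmianOn.rotate (hT : ∀ c, IsLanguage (T c)) {a : Bool} {u : Bool → List Bool}
    (h : SturmianOn T F) (hF : ∀ e, F e = u e ++ [a]) : SturmianOn T fun e => a :: u e := by
  intro c
  rw [(hT c).imageLang_rotate, ← funext hF]
  exact h c

theorem SturmianOn.almostCommute_of_head (hT : ∀ c, IsLanguage (T c))
    (hT' : ∀ c, IsSturmianLang (T c)) (h : SturmianOn T F)
    (ih : ∀ G : Bool → List Bool, SturmianOn T G →
      (G true).length + (G false).length < (F true).length + (F false).length →
      AlmostCommute (G true) (G false))
    {a : Bool} {v : Bool → List Bool} (hF : ∀ e, F e = a :: v e) :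
    AlmostCommute (F true) (F false) := by
  have hlang : ∀ c, IsLanguage (imageLang F (T c)) := fun c =>
    (hT c).imageLang fun e => by rw [hF]; exact List.cons_ne_nil _ _
  by_cases hsq : ∀ e, ¬ [!a, !a] <:+: F e
  · obtain ⟨G, hG, hFG, hlt⟩ := h.exists_lmor hT hF hsq
    rw [hFG, hFG]
    exact (ih G hG hlt).flatMap_lmor
  · push Not at hsq
    obtain ⟨e₀, he₀⟩ := hsq
    have hno : ∀ c, [a, a] ∉ imageLang F (T c) := by
      intro c hc
      exact (h c).not_square (hlang c) hc ⟨[e₀], (hT' c).letter_mem e₀, by simpa using he₀⟩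
    -- As `aa` does not occur, both values end with `!a`, and `F` is conjugated by this letter.
    have hend : ∀ e, ∃ u, F e = u ++ [!a] := by
      intro e
      obtain hnil | ⟨u, x, hx⟩ := List.eq_nil_or_concat' (F e)
      · rw [hF] at hnil
        simp at hnil
      obtain rfl | rfl := Bool.eq_or_eq_not x a
      · obtain ⟨e', he'⟩ := (hT true).exists_append_mem ((hT' true).letter_mem e)
        refine absurd ⟨_, he', u, v e', ?_⟩ (hno true)
        simp [hx, hF e']
      · exact ⟨u, hx⟩
    choose u hu using hend
    have h' := h.rotate hT hu
    obtain ⟨G, hG, hFG, hlt⟩ := h'.exists_lmor (a := !a) (v := u) hT (fun e => rfl) (by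
      intro e he
      apply hno true
      rw [Bool.not_not] at he
      rw [funext hu, ← (hT true).imageLang_rotate]
      exact ⟨[e], (hT' true).letter_mem e, by simpa using he⟩)
    have hG' := (ih G hG (by
      rw [hu, hu]
      simpa using hlt)).flatMap_lmor (c := !a)
    rw [← hFG, ← hFG] at hG'
    rw [hu, hu]
    exact hG'.rotate

/-- If the values of `F` have different first letters and different last letters, then both of
them are single letters. -/
theorem SturmianOn.almostCommute_of_ne (hT : ∀ c, IsLanguage (T c))
    (hT' : ∀ c, IsSturmianLang (T c)) (h : SturmianOn T F)
    (h1 : ∀ c, [c, c, c] ∈ T c) (h2 : ∀ c, [c, c, !c] ∈ T c) (h3 : ∀ c, [!c, c, c] ∈ T c)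
    (h4 : ∀ c, [c, !c, c] ∈ T c) {a b : Bool} {p q p' q' : List Bool}
    (hp : F true = a :: p) (hq : F false = (!a) :: q) (hp' : F true = p' ++ [b])
    (hq' : F false = q' ++ [!b]) : AlmostCommute (F true) (F false) := by
  have hlang : ∀ c, IsLanguage (imageLang F (T c)) := fun c =>
    (hT c).imageLang fun e => by cases e <;> simp [hp, hq]
  have hmem : ∀ c {w v : List Bool}, w ∈ T c → v <:+: w.flatMap F → v ∈ imageLang F (T c) :=
    fun c w v hw hv => ⟨w, hw, hv⟩
  obtain rfl : b = a := by
    by_contra hba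
    obtain rfl : b = !a := Bool.eq_not_of_ne hba
    refine (h true).not_square (hlang true) (e := a) (hmem true ((hT' true).pair_mem (hT _) false)
      ⟨q', p, ?_⟩) (hmem true ((hT' true).pair_mem (hT _) true) ⟨p', q, ?_⟩)
    · simp only [List.flatMap_cons, List.flatMap_nil, Bool.not_false, hp, hq']; simp
    · simp only [List.flatMap_cons, List.flatMap_nil, Bool.not_true, hp', hq]; simp
  have hsq1 : ∀ e, ¬ [!b, !b] <:+: F e := fun e he =>
    (h true).not_square (hlang true) (e := b) (hmem true ((hT _).infix_mem (h1 true)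
      (⟨[], [true], rfl⟩ : [true, true] <:+: _)) ⟨p', p, by
        simp only [List.flatMap_cons, List.flatMap_nil]
        nth_rw 1 [hp']
        rw [hp]; simp⟩)
      (hmem true ((hT' true).letter_mem e) (by simpa using he))
  have hsq2 : ∀ e, ¬ [b, b] <:+: F e := fun e he =>
    (h false).not_square (hlang false) (e := b)
      (hmem false ((hT' false).letter_mem e) (by simpa using he))
      (hmem false ((hT _).infix_mem (h1 false)
      (⟨[], [false], rfl⟩ : [false, false] <:+: _)) ⟨q', q, by
        simp only [List.flatMap_cons, List.flatMap_nil]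
        nth_rw 1 [hq']
        rw [hq]; simp⟩)
  have hchain : ∀ e, (F e).IsChain (· ≠ ·) := fun e => isChain_ne_of_not_infix fun x => by
    obtain rfl | rfl := Bool.eq_or_eq_not x b
    exacts [hsq2 e, hsq1 e]
  by_cases hlen : (F true).length + (F false).length ≤ 2
  · have hpn : p = [] := by
      rw [hp, hq] at hlen
      simp at hlen
      exact List.length_eq_zero_iff.1 (by omega)
    have hqn : q = [] := by
      rw [hp, hq] at hlen
      simp at hlen
      exact List.length_eq_zero_iff.1 (by omega)
    exact ⟨[], [], b, !b, by simp, by simp [hp, hq, hpn, hqn], by simp [hp, hq, hpn, hqn]⟩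
  exfalso
  -- With `w = F(1)`, the four words `bwb`, `bw!b`, `!bwb` and `!bw!b` occur: the last one in the
  -- alternating word `F(101)`. So `bw` and `!bw` are both right special.
  have hbig : F true ++ F false ++ F true =
      altWord b (2 * (F true).length + (F false).length) := by
    have hc : (F true ++ F false ++ F true).IsChain (· ≠ ·) := by
      rw [List.isChain_append, List.isChain_append]
      refine ⟨⟨hchain _, hchain _, ?_⟩, hchain _, ?_⟩
      · rw [hp', hq]; simp
      · rw [hq', hp, ← List.append_assoc, List.getLast?_concat]; simp
    have hcons : F true ++ F false ++ F true = b :: (p ++ F false ++ F true) := by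
      simp [hp]
    rw [hcons] at hc ⊢
    rw [eq_altWord hc]
    congr 1
    rw [hp]
    simp
    omega
  have hsmall : (!b) :: F true ++ [!b] = altWord (!b) ((F true).length + 2) := by
    have hc : ((!b) :: F true ++ [!b]).IsChain (· ≠ ·) := by
      rw [List.isChain_append]
      refine ⟨?_, List.isChain_singleton _, ?_⟩
      · have := hchain true
        rw [hp] at this ⊢
        exact List.isChain_cons_cons.2 ⟨by simp, this⟩
      · rw [hp', ← List.cons_append, List.getLast?_concat]; simp
    rw [List.cons_append] at hc ⊢
    rw [eq_altWord hc]
    simp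
  have hb : RightSpecial (imageLang F (T true)) (b :: F true) := by
    intro x
    obtain rfl | rfl := Bool.eq_or_eq_not x b
    · refine hmem true (h1 true) ⟨p', p, ?_⟩
      simp only [List.flatMap_cons, List.flatMap_nil]
      nth_rw 2 [hp']
      nth_rw 3 [hp]
      simp
    · refine hmem true (h2 true) ⟨p', q, ?_⟩
      simp only [List.flatMap_cons, List.flatMap_nil, Bool.not_true]
      rw [hq]
      nth_rw 2 [hp']
      simp
  have hnb : RightSpecial (imageLang F (T true)) ((!b) :: F true) := by
    intro x
    obtain rfl | rfl := Bool.eq_or_eq_not x b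
    · refine hmem true (h3 true) ⟨q', p, ?_⟩
      simp only [List.flatMap_cons, List.flatMap_nil, Bool.not_true]
      nth_rw 3 [hp]
      rw [hq']
      simp
    · refine hmem true (h4 true) ?_
      simp only [List.flatMap_cons, List.flatMap_nil, Bool.not_true, List.append_nil]
      rw [← List.append_assoc, hbig, hsmall]
      obtain ⟨n, hn⟩ : ∃ n, 2 * (F true).length + (F false).length = n + 1 :=
        ⟨2 * (F true).length + (F false).length - 1, by omega⟩
      rw [hn]
      exact List.infix_cons (altWord_prefix (!b) (by omega)).isInfix
  have := (h true ((F true).length + 1)).unique ⟨by simp, hb⟩ ⟨by simp, hnb⟩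
  simp at this

/-- If a morphism maps some Sturmian languages that contain the words `ccc`, `cce`, `ecc`, `cec`
to Sturmian languages, for both orders `c`, `e` of the letters, then its values almost commute. -/
theorem SturmianOn.almostCommute (hT : ∀ c, IsLanguage (T c))
    (hT' : ∀ c, IsSturmianLang (T c)) (h1 : ∀ c, [c, c, c] ∈ T c)
    (h2 : ∀ c, [c, c, !c] ∈ T c) (h3 : ∀ c, [!c, c, c] ∈ T c) (h4 : ∀ c, [c, !c, c] ∈ T c)
    (h : SturmianOn T F) : AlmostCommute (F true) (F false) := by
  induction hn : (F true).length + (F false).length using Nat.strong_induction_on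
    generalizing F with
  | _ n ih =>
  have ih' : ∀ G : Bool → List Bool, SturmianOn T G →
      (G true).length + (G false).length < n → AlmostCommute (G true) (G false) :=
    fun G hG hlt => ih _ hlt hG rfl
  have hne := (h true).ne_nil
  obtain ⟨a, p, hp⟩ := List.exists_cons_of_ne_nil (hne true)
  obtain ⟨a', q, hq⟩ := List.exists_cons_of_ne_nil (hne false)
  obtain ⟨p', b, hp'⟩ := (List.eq_nil_or_concat' (F true)).resolve_left (hne true)
  obtain ⟨q', b', hq'⟩ := (List.eq_nil_or_concat' (F false)).resolve_left (hne false)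
  obtain rfl | rfl := Bool.eq_or_eq_not a' a
  · refine h.almostCommute_of_head hT hT' (by rwa [hn]) (a := a')
      (v := fun e => if e = true then p else q) fun e => ?_
    cases e
    exacts [hq, hp]
  obtain rfl | rfl := Bool.eq_or_eq_not b' b
  · have hF : ∀ e, F e = (if e = true then p' else q') ++ [b'] := by
      intro e
      cases e
      exacts [hq', hp']
    have := (h.rotate hT hF).almostCommute_of_head hT hT' (fun G hG hlt => ih' G hG (by
      rw [← hn, hF, hF]
      simpa using hlt)) fun e => rfl
    rw [hF, hF]
    exact this.rotate
  · exact h.almostCommute_of_ne hT hT' h1 h2 h3 h4 hp hq hp' hq'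

end Reflect

/-! ### Factors and images of infinite words -/

section InfiniteWords

variable {A B C : Type*}

/-- `wordSegment` as a list. -/
def segment (x : ℕ → A) (m n : ℕ) : List A :=
  List.ofFn fun t : Fin n => x (m + t)

@[simp] theorem length_segment (x : ℕ → A) (m n : ℕ) : (segment x m n).length = n := by
  simp [segment]

@[simp] theorem segment_zero (x : ℕ → A) (m : ℕ) : segment x m 0 = [] := by
  simp [segment]

theorem segment_add (x : ℕ → A) (m n k : ℕ) :
    segment x m (n + k) = segment x m n ++ segment x (m + n) k := by
  refine List.ext_getElem (by simp) fun i h1 h2 => ?_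
  rw [List.getElem_append]
  split
  · simp [segment]
  · rename_i h
    simp only [length_segment, not_lt] at h
    simp only [segment, List.getElem_ofFn, List.length_ofFn]
    congr 1
    omega

theorem segment_one (x : ℕ → A) (m : ℕ) : segment x m 1 = [x m] := by
  simp [segment]

theorem segment_prefix (x : ℕ → A) {m n : ℕ} (h : m ≤ n) : segment x 0 m <+: segment x 0 n := by
  obtain ⟨k, rfl⟩ := Nat.exists_eq_add_of_le h
  exact ⟨_, (segment_add x 0 m k).symm⟩

theorem eq_segment_of_prefix {x : ℕ → A} {l : List A} {n : ℕ} (h : l <+: segment x 0 n) :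
    l = segment x 0 l.length := by
  have hn := h.length_le
  rw [length_segment] at hn
  exact (List.prefix_of_prefix_length_le h (segment_prefix x hn) (by simp)).eq_of_length (by simp)

/-- The set of factors of an infinite word. -/
def factors (x : ℕ → A) : Set (List A) :=
  {w | ∃ m n, segment x m n = w}

theorem segment_mem_factors (x : ℕ → A) (m n : ℕ) : segment x m n ∈ factors x :=
  ⟨m, n, rfl⟩

theorem mem_factors_iff_infix {x : ℕ → A} {w : List A} :
    w ∈ factors x ↔ ∃ n, w <:+: segment x 0 n := by
  constructor
  · rintro ⟨m, n, rfl⟩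
    exact ⟨m + n, segment x 0 m, [], by simp [segment_add]⟩
  · rintro ⟨n, s, t, hst⟩
    have hn : n = s.length + w.length + t.length := by
      simpa [add_assoc] using (congrArg List.length hst).symm
    rw [hn, segment_add, segment_add] at hst
    have h1 := (List.append_inj hst (by simp)).1
    exact ⟨_, _, (List.append_inj h1 (by simp)).2.symm⟩

theorem isExtendable_factors (x : ℕ → A) : IsExtendable (factors x) where
  infix_mem := by
    intro v w hw hv
    obtain ⟨n, hn⟩ := mem_factors_iff_infix.1 hw
    exact mem_factors_iff_infix.2 ⟨n, hv.trans hn⟩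
  exists_append_mem := by
    rintro u ⟨m, n, rfl⟩
    exact ⟨x (m + n), m, n + 1, by rw [segment_add, segment_one]⟩

/-- The infinite word `y` is the image of the infinite word `x` under the morphism with values `F`
on letters. -/
def IsImage (F : A → List B) (x : ℕ → A) (y : ℕ → B) : Prop :=
  (∀ n, (segment x 0 n).flatMap F = segment y 0 ((segment x 0 n).flatMap F).length) ∧
    ∀ N, ∃ n, N ≤ ((segment x 0 n).flatMap F).length

/-- The values on letters, as lists, of a morphism of the free monoid. -/
def letterValues (f : Morphism A) (a : A) : List A :=
  FreeMonoid.toList (f (FreeMonoid.of a))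

theorem toList_apply (f : Morphism A) (w : FreeMonoid A) :
    FreeMonoid.toList (f w) = (FreeMonoid.toList w).flatMap (letterValues f) := by
  induction w using FreeMonoid.recOn with
  | one => simp
  | of_mul a w ih => simp [ih, letterValues]

theorem isInfiniteImage_iff {f : Morphism A} {x y : ℕ → A} :
    IsInfiniteImage f x y ↔ IsImage (letterValues f) x y := by
  have h : ∀ n, (segment x 0 n).flatMap (letterValues f) =
      FreeMonoid.toList (f (wordSegment x 0 n)) := fun n => (toList_apply f _).symm
  unfold IsImage
  simp only [h]
  rfl

theorem letterValues_mul (f g : Morphism A) (a : A) :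
    letterValues (f * g) a = (letterValues g a).flatMap (letterValues f) :=
  toList_apply f _

theorem IsImage.factors_eq {F : A → List B} {x : ℕ → A} {y : ℕ → B} (h : IsImage F x y) :
    factors y = imageLang F (factors x) := by
  ext v
  constructor
  · intro hv
    obtain ⟨m, hm⟩ := mem_factors_iff_infix.1 hv
    obtain ⟨n, hn⟩ := h.2 m
    refine ⟨_, segment_mem_factors x 0 n, ?_⟩
    rw [h.1]
    exact hm.trans (segment_prefix y hn).isInfix
  · rintro ⟨w, hw, hv⟩
    obtain ⟨n, hn⟩ := mem_factors_iff_infix.1 hw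
    refine mem_factors_iff_infix.2 ⟨((segment x 0 n).flatMap F).length, ?_⟩
    rw [← h.1]
    exact hv.trans (hn.flatMap F)

theorem IsImage.comp_iff {F : A → List B} {G : B → List C} {x : ℕ → A} {y : ℕ → B} {z : ℕ → C}
    (h : IsImage F x y) :
    IsImage G y z ↔ IsImage (fun a => (F a).flatMap G) x z := by
  have hFG : ∀ n, (segment x 0 n).flatMap (fun a => (F a).flatMap G) =
      (segment y 0 ((segment x 0 n).flatMap F).length).flatMap G := fun n => by
    rw [← h.1, List.flatMap_assoc]
  unfold IsImage
  simp only [hFG]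
  constructor
  · rintro ⟨h1, h2⟩
    refine ⟨fun n => h1 _, fun N => ?_⟩
    obtain ⟨m, hm⟩ := h2 N
    obtain ⟨n, hn⟩ := h.2 m
    exact ⟨n, hm.trans ((segment_prefix y hn).flatMap G).length_le⟩
  · rintro ⟨h1, h2⟩
    refine ⟨fun m => ?_, fun N => ?_⟩
    · obtain ⟨n, hn⟩ := h.2 m
      have := (segment_prefix y hn).flatMap G
      rw [h1] at this
      exact eq_segment_of_prefix this
    · obtain ⟨n, hn⟩ := h2 N
      exact ⟨_, hn⟩

/-- An increasing sequence of finite words has a limit. -/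
theorem exists_limit {W : ℕ → List A} (h : ∀ n, W n <+: W (n + 1))
    (hlen : ∀ N, ∃ n, N ≤ (W n).length) : ∃ z : ℕ → A, ∀ n, W n = segment z 0 (W n).length := by
  have hmono : ∀ {m n}, m ≤ n → W m <+: W n := by
    intro m n hmn
    induction hmn with
    | refl => exact List.prefix_rfl
    | step _ ih => exact ih.trans (h _)
  choose N hN using fun t : ℕ => hlen (t + 1)
  refine ⟨fun t => (W (N t))[t]'(hN t), fun n => List.ext_getElem (by simp) fun t h1 h2 => ?_⟩
  simp only [segment, List.getElem_ofFn, Nat.zero_add]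
  rcases le_total n (N t) with hle | hle
  · exact (hmono hle).getElem h1
  · exact ((hmono hle).getElem (hN t)).symm

theorem exists_isImage {F : A → List B} {x : ℕ → A}
    (h : ∀ N, ∃ n, N ≤ ((segment x 0 n).flatMap F).length) : ∃ y, IsImage F x y := by
  obtain ⟨y, hy⟩ := exists_limit
    (W := fun n => (segment x 0 n).flatMap F)
    (fun n => (segment_prefix x n.le_succ).flatMap F) h
  exact ⟨y, hy, h⟩

theorem le_length_flatMap {F : A → List B} {w : List A} (h : ∀ a ∈ w, F a ≠ []) :
    w.length ≤ (w.flatMap F).length := by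
  induction w with
  | nil => simp
  | cons a w ih =>
    have h1 := List.length_pos_of_ne_nil (h a (by simp))
    have h2 := ih fun b hb => h b (by simp [hb])
    simp only [List.length_cons, List.flatMap_cons, List.length_append]
    omega

theorem exists_isImage_of_ne_nil {F : A → List B} {x : ℕ → A} (h : ∀ t, F (x t) ≠ []) :
    ∃ y, IsImage F x y := by
  refine exists_isImage fun N => ⟨N, ?_⟩
  have := le_length_flatMap (F := F) (w := segment x 0 N) (by
    intro a ha
    obtain ⟨t, rfl⟩ := (List.mem_ofFn' _ _).1 ha
    exact h _)
  simpa using this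

end InfiniteWords

/-! ### Sturmian words and their languages -/

section SturmianWords

variable {A B : Type*}

theorem complexity_eq (x : ℕ → A) (n : ℕ) :
    complexity x n = (Set.range fun m => segment x m n).ncard :=
  rfl

theorem finite_range_segment [Finite A] (x : ℕ → A) (n : ℕ) :
    (Set.range fun m => segment x m n).Finite :=
  (List.finite_length_eq A n).subset (by rintro _ ⟨m, rfl⟩; simp)

theorem mem_range_segment {x : ℕ → A} {n : ℕ} {w : List A} :
    w ∈ (Set.range fun m => segment x m n) ↔ w.length = n ∧ w ∈ factors x := by
  constructor
  · rintro ⟨m, rfl⟩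
    exact ⟨by simp, segment_mem_factors x m n⟩
  · rintro ⟨rfl, m, n, rfl⟩
    exact ⟨m, by simp⟩

theorem complexity_zero (x : ℕ → A) : complexity x 0 = 1 := by
  rw [complexity_eq]
  simp

/-- The right special words of length `n`. -/
def specialOfLength (S : Set (List Bool)) (n : ℕ) : Set (List Bool) :=
  {v | v.length = n ∧ RightSpecial S v}

/-- The first difference of the complexity function counts the right special words. -/
theorem complexity_succ (x : ℕ → Bool) (n : ℕ) :
    complexity x (n + 1) = complexity x n + (specialOfLength (factors x) n).ncard := by
  have hx := isExtendable_factors x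
  set E : Bool → Set (List Bool) := fun e => {v | v.length = n ∧ v ++ [e] ∈ factors x} with hE
  have hfin : ∀ e, (E e).Finite := fun e =>
    (List.finite_length_eq Bool n).subset fun v hv => hv.1
  have hinj : ∀ e : Bool, Function.Injective fun v : List Bool => v ++ [e] := fun e u v h => by
    simpa using h
  have h1 : (Set.range fun m => segment x m (n + 1)) =
      (fun v => v ++ [true]) '' E true ∪ (fun v => v ++ [false]) '' E false := by
    ext w
    rw [mem_range_segment]
    constructor
    · rintro ⟨hw, hwx⟩
      obtain ⟨v, e, rfl⟩ := (List.eq_nil_or_concat' w).resolve_left (by rintro rfl; simp at hw)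
      have hv : v ∈ E e := ⟨by simpa using hw, hwx⟩
      cases e
      exacts [Or.inr ⟨v, hv, rfl⟩, Or.inl ⟨v, hv, rfl⟩]
    · rintro (⟨v, hv, rfl⟩ | ⟨v, hv, rfl⟩)
      exacts [⟨by simp [hv.1], hv.2⟩, ⟨by simp [hv.1], hv.2⟩]
  have h2 : (Set.range fun m => segment x m n) = E true ∪ E false := by
    ext w
    rw [mem_range_segment]
    constructor
    · rintro ⟨hw, hwx⟩
      obtain ⟨e, he⟩ := hx.exists_append_mem hwx
      cases e
      exacts [Or.inr ⟨hw, he⟩, Or.inl ⟨hw, he⟩]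
    · rintro (hv | hv)
      exacts [⟨hv.1, hx.infix_mem hv.2 ⟨[], [true], by simp⟩⟩,
        ⟨hv.1, hx.infix_mem hv.2 ⟨[], [false], by simp⟩⟩]
  have h3 : specialOfLength (factors x) n = E true ∩ E false := by
    ext v
    simp only [specialOfLength, RightSpecial, Bool.forall_bool, hE, Set.mem_inter_iff,
      Set.mem_ofPred_eq]
    tauto
  rw [complexity_eq, complexity_eq, h1, h2, h3, Set.ncard_union_add_ncard_inter _ _ (hfin _)
    (hfin _), Set.ncard_union_eq ?_ ((hfin _).image _) ((hfin _).image _), Set.ncard_image_of_injective _ (hinj _),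
    Set.ncard_image_of_injective _ (hinj _)]
  · rw [Set.disjoint_left]
    rintro _ ⟨u, -, rfl⟩ ⟨v, -, h⟩
    simp at h

theorem uniqueSpecial_iff {S : Set (List Bool)} {n : ℕ} :
    UniqueSpecial S n ↔ (specialOfLength S n).ncard = 1 := by
  rw [Set.ncard_eq_one]
  constructor
  · rintro ⟨v, hv, huniq⟩
    exact ⟨v, Set.eq_singleton_iff_unique_mem.2 ⟨hv, huniq⟩⟩
  · rintro ⟨v, hv⟩
    obtain ⟨h1, h2⟩ := Set.eq_singleton_iff_unique_mem.1 hv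
    exact ⟨v, h1, h2⟩

/-- A binary word is Sturmian if and only if its language is. -/
theorem isSturmian_iff {x : ℕ → Bool} : IsSturmian x ↔ IsSturmianLang (factors x) := by
  simp only [IsSturmianLang, uniqueSpecial_iff, IsSturmian]
  constructor
  · intro h n
    have := complexity_succ x n
    rw [h, h] at this
    omega
  · intro h n
    induction n with
    | zero => exact complexity_zero x
    | succ n ih => rw [complexity_succ, h, ih]

theorem segment_shift (x : ℕ → A) (N m n : ℕ) :
    segment (fun t => x (N + t)) m n = segment x (N + m) n := by
  simp [segment, add_assoc]

/-- Every factor of a Sturmian word occurs arbitrarily far in it. Otherwise, some tail has no right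
special word of some length, and its complexity is bounded. -/
theorem IsSturmian.factors_shift {x : ℕ → Bool} (h : IsSturmian x) (N : ℕ) :
    factors (fun t => x (N + t)) = factors x := by
  set y : ℕ → Bool := fun t => x (N + t) with hy
  have hsub : factors y ⊆ factors x := by
    rintro _ ⟨m, n, rfl⟩
    exact ⟨N + m, n, (segment_shift x N m n).symm⟩
  have hspec : ∀ n, specialOfLength (factors y) n ⊆ specialOfLength (factors x) n :=
    fun n v hv => ⟨hv.1, fun e => hsub (hv.2 e)⟩
  have hone : ∀ n, (specialOfLength (factors x) n).ncard = 1 := fun n =>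
    uniqueSpecial_iff.1 (isSturmian_iff.1 h n)
  have hfin : ∀ n, (specialOfLength (factors x) n).Finite := fun n =>
    Set.finite_of_ncard_ne_zero (by rw [hone]; exact one_ne_zero)
  by_cases hne : ∀ n, (specialOfLength (factors y) n).Nonempty
  · have hyst : IsSturmian y := isSturmian_iff.2 fun n => uniqueSpecial_iff.2 (by
      have h1 := Set.ncard_le_ncard (hspec n) (hfin n)
      have h2 := (Set.ncard_pos ((hfin n).subset (hspec n))).2 (hne n)
      rw [hone] at h1
      omega)
    refine hsub.antisymm fun w hw => ?_
    have heq : (Set.range fun m => segment y m w.length) =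
        (Set.range fun m => segment x m w.length) := by
      refine Set.eq_of_subset_of_ncard_le ?_ ?_ (finite_range_segment _ _)
      · intro v hv
        rw [mem_range_segment] at hv ⊢
        exact ⟨hv.1, hsub hv.2⟩
      · rw [← complexity_eq, ← complexity_eq, h, hyst]
    exact (mem_range_segment.1 (heq.symm ▸ mem_range_segment.2 ⟨rfl, hw⟩)).2
  · exfalso
    push Not at hne
    obtain ⟨n₀, hn₀⟩ := hne
    have hempty : ∀ n, n₀ ≤ n → specialOfLength (factors y) n = ∅ := by
      intro n hn
      rw [Set.eq_empty_iff_forall_notMem] at hn₀ ⊢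
      rintro v ⟨hvn, hv⟩
      obtain ⟨u, -, hun, hu⟩ := hv.exists_suffix (n := n₀) (isExtendable_factors y) (by omega)
      exact hn₀ u ⟨hun, hu⟩
    have hconst : ∀ k, complexity y (n₀ + k) = complexity y n₀ := by
      intro k
      induction k with
      | zero => rfl
      | succ k ih => rw [← add_assoc, complexity_succ, hempty _ (by omega), ih]; simp
    have hle : ∀ n, complexity x n ≤ complexity y n + N := by
      intro n
      have : (Set.range fun m => segment x m n) ⊆ (Set.range fun m => segment y m n) ∪
          (fun m => segment x m n) '' Set.Iio N := by
        rintro _ ⟨m, rfl⟩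
        rcases lt_or_ge m N with hm | hm
        · exact Or.inr ⟨m, hm, rfl⟩
        · exact Or.inl ⟨m - N, by
            simp only [hy, segment_shift]
            congr 1
            omega⟩
      refine (Set.ncard_le_ncard this ((finite_range_segment _ _).union
        ((Set.finite_Iio N).image _))).trans ((Set.ncard_union_le _ _).trans ?_)
      rw [← complexity_eq]
      refine Nat.add_le_add_left ((Set.ncard_image_le (Set.finite_Iio N)).trans ?_) _
      simp
    have h1 := hle (n₀ + (complexity y n₀ + N))
    rw [hconst, h] at h1
    omega

theorem IsSturmian.isLanguage {x : ℕ → Bool} (h : IsSturmian x) : IsLanguage (factors x) where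
  toIsExtendable := isExtendable_factors x
  connect := by
    rintro _ v ⟨m, n, rfl⟩ hv
    rw [← h.factors_shift (m + n)] at hv
    obtain ⟨k, l, rfl⟩ := hv
    refine ⟨segment x (m + n) k, m, n + k + l, ?_⟩
    rw [segment_shift, segment_add, segment_add, add_assoc m n k]
  letter := ⟨_, 0, 1, segment_one x 0⟩

theorem segment_comp (e : A → B) (x : ℕ → A) (m n : ℕ) :
    segment (e ∘ x) m n = (segment x m n).map e := by
  simp [segment, List.map_ofFn, Function.comp_def]

theorem isSturmian_comp_iff {e : A → B} (he : Function.Injective e) {x : ℕ → A} :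
    IsSturmian (e ∘ x) ↔ IsSturmian x := by
  have : ∀ n, complexity (e ∘ x) n = complexity x n := by
    intro n
    simp only [complexity_eq, segment_comp]
    rw [show (Set.range fun m => (segment x m n).map e) =
      List.map e '' (Set.range fun m => segment x m n) by rw [← Set.range_comp]; rfl]
    exact Set.ncard_image_of_injective _ (List.map_injective_iff.2 he)
  simp only [IsSturmian, this]

end SturmianWords

/-! ### Existence of Sturmian words -/

section Fibonacci

/-- The Fibonacci morphism `1 ↦ 10`, `0 ↦ 1`, which is `L_1` after the exchange of letters. -/
def fibMor (e : Bool) : List Bool :=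
  lmor true (!e)

/-- The finite Fibonacci words. -/
def fibWord : ℕ → List Bool
  | 0 => [true]
  | n + 1 => (fibWord n).flatMap fibMor

theorem fibMor_ne_nil (e : Bool) : fibMor e ≠ [] :=
  lmor_ne_nil _ _

theorem fibWord_prefix (n : ℕ) : fibWord n <+: fibWord (n + 1) := by
  induction n with
  | zero => exact ⟨[false], rfl⟩
  | succ n ih => exact ih.flatMap fibMor

theorem lt_length_fibWord (n : ℕ) : ∃ l, fibWord n = true :: l ∧ n ≤ l.length := by
  induction n with
  | zero => exact ⟨[], rfl, le_rfl⟩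
  | succ n ih =>
    obtain ⟨l, hl, hn⟩ := ih
    refine ⟨false :: l.flatMap fibMor, ?_, ?_⟩
    · rw [fibWord, hl]
      rfl
    · have := le_length_flatMap (F := fibMor) (w := l) fun a _ => fibMor_ne_nil a
      rw [List.length_cons]
      omega

theorem exists_isImage_fibMor : ∃ z : ℕ → Bool, IsImage fibMor z z ∧ z 0 = true := by
  obtain ⟨z, hz⟩ := exists_limit fibWord_prefix fun N => ⟨N, by
    obtain ⟨l, hl, hn⟩ := lt_length_fibWord N
    rw [hl]
    simp
    omega⟩
  refine ⟨z, ⟨fun n => ?_, fun N => ⟨N, ?_⟩⟩, ?_⟩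
  · obtain ⟨l, hl, hn⟩ := lt_length_fibWord n
    have h1 : segment z 0 n <+: fibWord n := by
      rw [hz]
      exact segment_prefix z (by rw [hl]; simp; omega)
    have h2 := h1.flatMap fibMor
    rw [← fibWord, hz] at h2
    exact eq_segment_of_prefix h2
  · have := le_length_flatMap (F := fibMor) (w := segment z 0 N) fun a _ => fibMor_ne_nil a
    simpa using this
  · have := hz 0
    rw [fibWord, List.length_singleton, segment_one] at this
    simpa using this.symm

theorem exists_isSturmian : ∃ z : ℕ → Bool, IsSturmian z := by
  obtain ⟨z, hz, hz0⟩ := exists_isImage_fibMor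
  refine ⟨z, isSturmian_iff.2 fun n => ?_⟩
  have hext := isExtendable_factors z
  have hext' : IsExtendable (imageLang (fun e => [!e]) (factors z)) :=
    hext.imageLang fun e => by simp
  have hS : imageLang (lmor true) (imageLang (fun e => [!e]) (factors z)) = factors z := by
    have : (fun e : Bool => [!e].flatMap (lmor true)) = fibMor := by
      funext e
      simp [fibMor]
    rw [imageLang_comp, this]
    exact hz.factors_eq.symm
  suffices h : ∀ m ≤ n, UniqueSpecial (factors z) m from h n le_rfl
  induction n with
  | zero =>
    intro m hm
    obtain rfl : m = 0 := by omega
    refine ⟨[], ⟨rfl, fun e => ?_⟩, fun v hv => List.length_eq_zero_iff.1 hv.1⟩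
    have hpre : fibMor true ∈ factors z := by
      rw [hz.factors_eq]
      refine ⟨_, segment_mem_factors z 0 1, ?_⟩
      rw [segment_one, hz0]
      simp
    cases e
    · exact hext.infix_mem hpre ⟨[true], [], rfl⟩
    · exact hext.infix_mem hpre ⟨[], [false], rfl⟩
  | succ n ih =>
    intro m hm
    rw [← hS]
    exact UniqueSpecial.imageLang_lmor hext' (fun k hk => (ih k hk).imageLang_not hext) hm

/-- For each letter `c` there is a Sturmian word with the factors `ccc`, `cce`, `ecc`, `cec`, where
`e` is the other letter: the image of any Sturmian word under `L_c³`. -/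
theorem exists_isSturmian_factors (c : Bool) : ∃ z : ℕ → Bool, IsSturmian z ∧
    [c, c, c] ∈ factors z ∧ [c, c, !c] ∈ factors z ∧ [!c, c, c] ∈ factors z ∧
    [c, !c, c] ∈ factors z := by
  obtain ⟨x, hx⟩ := exists_isSturmian
  have hl := hx.isLanguage
  set F : Bool → List Bool := fun e =>
    (lmor c e).flatMap fun e => (lmor c e).flatMap (lmor c) with hF
  have hFS : imageLang F (factors x) =
      imageLang (lmor c) (imageLang (lmor c) (imageLang (lmor c) (factors x))) := by
    rw [imageLang_comp, imageLang_comp]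
  have hFc : F c = [c] := by simp [hF]
  have hFn : F (!c) = [c, c, c, !c] := by simp [hF]
  obtain ⟨z, hz⟩ := exists_isImage_of_ne_nil (F := F) (x := x) fun t => by
    obtain h | h := Bool.eq_or_eq_not (x t) c <;> rw [h]
    · simp [hFc]
    · simp [hFn]
  have hzF := hz.factors_eq
  have hzs : IsSturmian z := by
    rw [isSturmian_iff, hzF, hFS]
    have h1 := isExtendable_factors x
    have h2 := h1.imageLang (lmor_ne_nil c)
    have h3 := h2.imageLang (lmor_ne_nil c)
    rw [isSturmianLang_imageLang_lmor h3, isSturmianLang_imageLang_lmor h2,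
      isSturmianLang_imageLang_lmor h1]
    exact isSturmian_iff.1 hx
  -- `!c` is followed in `x` by a word of length 2, whose image starts with `cc`.
  obtain ⟨a, ha⟩ := hl.exists_append_mem ((isSturmian_iff.1 hx).letter_mem (!c))
  obtain ⟨b, hb⟩ := hl.exists_append_mem ha
  have hmain : [c, c, c, !c, c, c] ∈ factors z := by
    rw [hzF]
    refine ⟨_, hb, ?_⟩
    obtain rfl | rfl := Bool.eq_or_eq_not a c
    · obtain rfl | rfl := Bool.eq_or_eq_not b a
      · exact ⟨[], [], by simp [hFc, hFn]⟩
      · exact ⟨[], [a, a, !a], by simp [hFc, hFn]⟩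
    · exact ⟨[], c :: (!c) :: F b, by simp [hFn]⟩
  have hz' := isExtendable_factors z
  exact ⟨z, hzs, hz'.infix_mem hmain ⟨[], [!c, c, c], rfl⟩,
    hz'.infix_mem hmain ⟨[c], [c, c], rfl⟩, hz'.infix_mem hmain ⟨[c, c, c], [], rfl⟩,
    hz'.infix_mem hmain ⟨[c, c], [c], rfl⟩⟩

end Fibonacci

/-! ### Morphisms with Sturmian erasures -/

section Erasures

/-- The word obtained from `l` by erasing the letter `a`. -/
def eraseLetter (a : Fin 3) (l : List (Fin 3)) : List (Fin 3) :=
  l.filter (· ≠ a)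

@[simp] theorem eraseLetter_nil (a : Fin 3) : eraseLetter a [] = [] :=
  rfl

@[simp] theorem eraseLetter_cons_self (a : Fin 3) (l : List (Fin 3)) :
    eraseLetter a (a :: l) = eraseLetter a l := by
  simp [eraseLetter]

theorem eraseLetter_cons_of_ne {a b : Fin 3} (h : b ≠ a) (l : List (Fin 3)) :
    eraseLetter a (b :: l) = b :: eraseLetter a l := by
  simp [eraseLetter, h]

@[simp] theorem eraseLetter_append (a : Fin 3) (l l' : List (Fin 3)) :
    eraseLetter a (l ++ l') = eraseLetter a l ++ eraseLetter a l' := by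
  simp [eraseLetter]

theorem mem_eraseLetter {a b : Fin 3} {l : List (Fin 3)} :
    b ∈ eraseLetter a l ↔ b ∈ l ∧ b ≠ a := by
  simp [eraseLetter]

theorem letterValues_lift {A : Type*} (F : A → FreeMonoid A) (b : A) :
    letterValues (FreeMonoid.lift F : Morphism A) b = FreeMonoid.toList (F b) :=
  congrArg FreeMonoid.toList (FreeMonoid.lift_eval_of F b)

theorem letterValues_erase (a : Fin 3) (b : Fin 3) :
    letterValues (erase {a}) b = if b = a then [] else [b] := by
  refine (letterValues_lift _ b).trans ?_
  by_cases h : b = a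
  · simp [h]
  · simp [h]

theorem flatMap_erase (a : Fin 3) (l : List (Fin 3)) :
    l.flatMap (letterValues (erase {a})) = eraseLetter a l := by
  induction l with
  | nil => rfl
  | cons b l ih =>
    rw [List.flatMap_cons, ih, letterValues_erase]
    split
    · rename_i h
      simp [h]
    · rename_i h
      simp [eraseLetter_cons_of_ne h]

/-- Letters with empty image may be erased before a morphism is applied. -/
theorem flatMap_eraseLetter {B : Type*} {F : Fin 3 → List B} {i : Fin 3} (hF : F i = [])
    (l : List (Fin 3)) : (eraseLetter i l).flatMap F = l.flatMap F := by
  induction l with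
  | nil => rfl
  | cons b l ih =>
    by_cases h : b = i
    · subst h
      simp [hF, ih]
    · simp [eraseLetter_cons_of_ne h, ih]

theorem eraseLetter_flatMap (a : Fin 3) (F : Fin 3 → List (Fin 3)) (l : List (Fin 3)) :
    eraseLetter a (l.flatMap F) = l.flatMap fun b => eraseLetter a (F b) := by
  induction l with
  | nil => rfl
  | cons b l ih => simp [ih]

/-- For each letter `a`, the words obtained from `p` and `q` by erasing `a` almost commute. -/
def ErasuresAlmostCommute (p q : List (Fin 3)) : Prop :=
  ∀ a, AlmostCommute (eraseLetter a p) (eraseLetter a q)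

theorem ErasuresAlmostCommute.left_ne_nil {p q : List (Fin 3)} (h : ErasuresAlmostCommute p q) :
    p ≠ [] := by
  rintro rfl
  exact (h 0).left_ne_nil rfl

theorem ErasuresAlmostCommute.symm {p q : List (Fin 3)} (h : ErasuresAlmostCommute p q) :
    ErasuresAlmostCommute q p :=
  fun a => (h a).symm

/-- An identification of the two letters other than `a` with `Bool`. -/
theorem exists_embedding (a : Fin 3) :
    ∃ e : Bool → Fin 3, Function.Injective e ∧ ∀ b, b ∈ Set.range e ↔ b ≠ a := by
  refine ⟨fun t => cond t (a + 1) (a + 2), ?_, ?_⟩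
  · intro s t
    revert a s t
    decide
  · simp only [Set.mem_range]
    revert a
    decide

/-- The map from `Bool` onto the set of two letters `j`, `k`. -/
def pairEmb (j k : Fin 3) (t : Bool) : Fin 3 :=
  cond t j k

theorem pairEmb_injective {j k : Fin 3} (h : j ≠ k) : Function.Injective (pairEmb j k) := by
  intro s t hst
  cases s <;> cases t <;> simp_all [pairEmb, eq_comm]

theorem isImage_comp_left {A A' B : Type*} {e : A → A'} {F : A' → List B} {x : ℕ → A}
    {y : ℕ → B} : IsImage F (e ∘ x) y ↔ IsImage (fun a => F (e a)) x y := by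
  simp only [IsImage, segment_comp, List.flatMap_map]

theorem isImage_comp_right {A B B' : Type*} {e : B → B'} (he : Function.Injective e)
    {F : A → List B} {x : ℕ → A} {y : ℕ → B} :
    IsImage (fun a => (F a).map e) x (e ∘ y) ↔ IsImage F x y := by
  simp only [IsImage, segment_comp, ← List.map_flatMap, List.length_map,
    (List.map_injective_iff.2 he).eq_iff]

theorem exists_comp_eq {A B : Type*} {e : A → B} {y : ℕ → B} (h : ∀ t, y t ∈ Set.range e) :
    ∃ y', y = e ∘ y' := by
  choose y' hy' using h
  exact ⟨y', funext fun t => (hy' t).symm⟩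

/-- After erasing a letter, a morphism restricted to two letters is a binary morphism. -/
theorem exists_binary {a : Fin 3} {e : Bool → Fin 3} (he : ∀ b, b ∈ Set.range e ↔ b ≠ a)
    (F : Bool → List (Fin 3)) :
    ∃ G : Bool → List Bool, ∀ t, (G t).map e = eraseLetter a (F t) := by
  have h : ∀ t, ∃ l : List Bool, l.map e = eraseLetter a (F t) := by
    intro t
    have : eraseLetter a (F t) ∈ Set.range (List.map e) := by
      rw [Set.range_list_map]
      exact fun b hb => (he b).2 (mem_eraseLetter.1 hb).2
    exact this
  choose G hG using h
  exact ⟨G, hG⟩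

theorem ne_of_isInfiniteImage_erase {a : Fin 3} {x y : ℕ → Fin 3}
    (h : IsInfiniteImage (erase {a}) x y) (t : ℕ) : y t ≠ a := by
  have hy : [y t] ∈ factors y := ⟨t, 1, segment_one y t⟩
  rw [(isInfiniteImage_iff.1 h).factors_eq] at hy
  obtain ⟨w, -, hw⟩ := hy
  rw [flatMap_erase] at hw
  exact (mem_eraseLetter.1 (hw.subset (List.mem_singleton_self _))).2

variable {i j k : Fin 3}

/-- If all erasures of `f(j)` and `f(k)` almost commute, then the image under `f` of a Sturmian word
over `{j, k}` has Sturmian erasures. -/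
theorem exists_image_mem_WSE {f : Morphism (Fin 3)}
    (hf : ErasuresAlmostCommute (letterValues f j) (letterValues f k)) {y : ℕ → Bool}
    (hy : IsSturmian y) : ∃ X, IsInfiniteImage f (pairEmb j k ∘ y) X ∧ X ∈ WSE := by
  obtain ⟨X, hX⟩ := exists_isImage_of_ne_nil (F := letterValues f) (x := pairEmb j k ∘ y) fun t => by
    show letterValues f (pairEmb j k (y t)) ≠ []
    cases y t
    exacts [hf.symm.left_ne_nil, hf.left_ne_nil]
  refine ⟨X, isInfiniteImage_iff.2 hX, fun a => ?_⟩
  obtain ⟨e, he, hea⟩ := exists_embedding a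
  obtain ⟨G, hG⟩ := exists_binary hea fun t => letterValues f (pairEmb j k t)
  have hAC : AlmostCommute (G true) (G false) := by
    refine AlmostCommute.of_map he ?_
    rw [hG, hG]
    exact hf a
  obtain ⟨Y, hY⟩ := exists_isImage_of_ne_nil (F := G) (x := y) fun t => by
    cases y t
    exacts [hAC.right_ne_nil, hAC.left_ne_nil]
  refine ⟨e ∘ Y, ?_, ?_⟩
  · rw [isInfiniteImage_iff, hX.comp_iff, isImage_comp_left]
    simp only [flatMap_erase, ← hG]
    exact (isImage_comp_right he).2 hY
  · rw [isSturmian_comp_iff he, isSturmian_iff, hY.factors_eq]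
    exact (isSturmian_iff.1 hy).imageLang_of_almostCommute hAC hy.isLanguage

/-- The morphism that maps `j` to `p`, `k` to `q` and the third letter to the empty word. -/
def pairMor (j k : Fin 3) (p q : List (Fin 3)) : Morphism (Fin 3) :=
  FreeMonoid.lift fun b =>
    if b = j then FreeMonoid.ofList p else if b = k then FreeMonoid.ofList q else 1

theorem letterValues_pairMor (p q : List (Fin 3)) (b : Fin 3) :
    letterValues (pairMor j k p q) b = if b = j then p else if b = k then q else [] := by
  refine (letterValues_lift _ b).trans ?_
  split_ifs <;> rfl

theorem almostCommute_singleton {A : Type*} {x y : A} (h : x ≠ y) : AlmostCommute [x] [y] :=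
  ⟨[], [], x, y, h, rfl, rfl⟩

/-- The morphism `i ↦ ε`, `j ↦ ji`, `k ↦ ki` has Sturmian erasures. -/
theorem erasuresAlmostCommute_base (hij : i ≠ j) (hik : i ≠ k) (hjk : j ≠ k)
    (hcov : ∀ a, a = i ∨ a = j ∨ a = k) : ErasuresAlmostCommute [j, i] [k, i] := by
  intro a
  rcases hcov a with rfl | rfl | rfl
  · simpa [eraseLetter_cons_of_ne, hij.symm, hik.symm] using almostCommute_singleton hjk
  · simpa [eraseLetter_cons_of_ne, hij, hjk.symm] using (almostCommute_singleton hik).append_left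
  · simpa [eraseLetter_cons_of_ne, hik, hjk] using
      ((almostCommute_singleton hij).append_left).symm

/-- A morphism that erases the letter `i` has Sturmian erasures if and only if all erasures of its
values at the other two letters almost commute. -/
theorem mem_MSEAt_iff (hij : i ≠ j) (hik : i ≠ k) (hjk : j ≠ k)
    (hcov : ∀ a, a = i ∨ a = j ∨ a = k) {f : Morphism (Fin 3)} :
    f ∈ MSEAt i ↔ letterValues f i = [] ∧
      ErasuresAlmostCommute (letterValues f j) (letterValues f k) := by
  constructor
  · rintro ⟨hf, hfi⟩
    have hfi : letterValues f i = [] := hfi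
    refine ⟨hfi, fun a => ?_⟩
    obtain ⟨e, he, hea⟩ := exists_embedding a
    obtain ⟨G, hG⟩ := exists_binary hea fun t => letterValues f (pairEmb j k t)
    choose z hz h1 h2 h3 h4 using exists_isSturmian_factors
    have hG' : SturmianOn (fun c => factors (z c)) G := by
      intro c
      obtain ⟨x, hx, hxW⟩ := exists_image_mem_WSE (j := j) (k := k)
        (f := pairMor j k [j, i] [k, i]) (by
          simpa [letterValues_pairMor, hjk.symm] using
            erasuresAlmostCommute_base hij hik hjk hcov) (hz c)
      obtain ⟨X, hX, hXW⟩ := hf x hxW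
      obtain ⟨Y, hY, hYs⟩ := hXW a
      obtain ⟨Y, rfl⟩ := exists_comp_eq (e := e) fun t =>
        (hea _).2 (ne_of_isInfiniteImage_erase hY t)
      rw [isInfiniteImage_iff] at hx hX hY
      rw [hX.comp_iff, hx.comp_iff, isImage_comp_left] at hY
      have hval : (fun t => (letterValues (pairMor j k [j, i] [k, i]) (pairEmb j k t)).flatMap
          fun b => (letterValues f b).flatMap (letterValues (erase {a}))) =
          fun t => (G t).map e := by
        funext t
        rw [hG]
        cases t <;> simp [letterValues_pairMor, pairEmb, hjk.symm, flatMap_erase, hfi]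
      rw [hval, isImage_comp_right he] at hY
      rw [isSturmian_comp_iff he, isSturmian_iff, hY.factors_eq] at hYs
      exact hYs
    have := hG'.almostCommute (fun c => (hz c).isLanguage) (fun c => isSturmian_iff.1 (hz c))
      h1 h2 h3 h4
    have := this.map he
    rwa [hG, hG] at this
  · rintro ⟨hfi, hf⟩
    refine ⟨fun x hx => ?_, hfi⟩
    obtain ⟨y, hy, hys⟩ := hx i
    obtain ⟨y, rfl⟩ := exists_comp_eq (e := pairEmb j k) fun t => by
      rcases (hcov (y t)).resolve_left (ne_of_isInfiniteImage_erase hy t) with h | h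
      exacts [⟨true, h.symm⟩, ⟨false, h.symm⟩]
    rw [isSturmian_comp_iff (pairEmb_injective hjk)] at hys
    obtain ⟨X, hX, hXW⟩ := exists_image_mem_WSE hf hys
    refine ⟨X, ?_, hXW⟩
    rw [isInfiniteImage_iff] at hX hy ⊢
    rw [hy.comp_iff] at hX
    convert hX using 1
    funext b
    rw [letterValues_erase]
    split
    · rename_i h
      simp [h, hfi]
    · simp

end Erasures

/-! ### Units among the morphisms that erase a letter -/

section Units

variable {i j k : Fin 3} {g : Morphism (Fin 3)}

/-- The word obtained from `gⁿ(a)` by erasing the letter `i`. -/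
def erasedIterate (i : Fin 3) (g : Morphism (Fin 3)) (n : ℕ) (a : Fin 3) : List (Fin 3) :=
  eraseLetter i (letterValues (g ^ n) a)

theorem letterValues_one {A : Type*} (a : A) : letterValues (1 : Morphism A) a = [a] :=
  rfl

theorem letterValues_pow_self (hg : letterValues g i = []) (n : ℕ) :
    letterValues (g ^ (n + 1)) i = [] := by
  rw [pow_succ, letterValues_mul, hg]
  rfl

theorem erasedIterate_self (hg : letterValues g i = []) (n : ℕ) : erasedIterate i g n i = [] := by
  cases n with
  | zero => simp [erasedIterate, letterValues_one]
  | succ n => simp [erasedIterate, letterValues_pow_self hg]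

theorem erasedIterate_one (a : Fin 3) :
    erasedIterate i g 1 a = eraseLetter i (letterValues g a) := by
  rw [erasedIterate, pow_one]

theorem erasedIterate_zero {a : Fin 3} (ha : a ≠ i) : erasedIterate i g 0 a = [a] := by
  rw [erasedIterate, pow_zero, letterValues_one, eraseLetter_cons_of_ne ha, eraseLetter_nil]

theorem erasedIterate_add (hg : letterValues g i = []) (m n : ℕ) (a : Fin 3) :
    erasedIterate i g (m + n) a = (erasedIterate i g n a).flatMap (erasedIterate i g m) := by
  rw [erasedIterate, pow_add, letterValues_mul, eraseLetter_flatMap]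
  exact (flatMap_eraseLetter (erasedIterate_self hg m) _).symm

theorem ne_of_mem_erasedIterate {n : ℕ} {a b : Fin 3} (h : b ∈ erasedIterate i g n a) : b ≠ i :=
  (mem_eraseLetter.1 h).2

/-- A morphism that, up to erasures of `i`, is the identity or the exchange of the other two
letters is a unit. -/
theorem isUnitMorphism_of_forall (hij : i ≠ j) (hg : letterValues g i = [])
    (h : ∀ a, a ≠ i → ∃ b, b ≠ i ∧ erasedIterate i g 1 a = [b] ∧ erasedIterate i g 1 b = [a]) :
    IsUnitMorphism g := by
  have hne : ∀ n a, a ≠ i → ∃ b, b ≠ i ∧ erasedIterate i g n a = [b] := by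
    intro n
    induction n with
    | zero => exact fun a ha => ⟨a, ha, erasedIterate_zero ha⟩
    | succ n ih =>
      intro a ha
      obtain ⟨b, hb, hab, -⟩ := h a ha
      obtain ⟨c, hc, hbc⟩ := ih b hb
      exact ⟨c, hc, by rw [erasedIterate_add hg, hab]; simpa using hbc⟩
  have hnil : ∀ a, a ≠ i → a ∉ nilpotentLetters g := by
    rintro a ha ⟨n, hn⟩
    obtain ⟨b, -, hb⟩ := hne n a ha
    rw [erasedIterate, show letterValues (g ^ n) a = [] from hn] at hb
    simp at hb
  have hN : nilpotentLetters g = {i} := by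
    ext a
    refine ⟨fun ha => by_contra fun h => hnil a h ha, ?_⟩
    rintro rfl
    exact ⟨1, letterValues_pow_self hg 0⟩
  refine ⟨fun ⟨n, hn⟩ => hnil j hij.symm ⟨n, hn j⟩, ?_⟩
  rintro ⟨a, ha, hperm⟩
  have hai : a ≠ i := by
    rintro rfl
    exact ha (by rw [hN]; rfl)
  have hret : a ∈ returningLetters g := by
    refine ⟨2, by norm_num, ?_⟩
    obtain ⟨b, hb, hab, hba⟩ := h a hai
    have h2 := erasedIterate_add hg 1 1 a
    rw [hab, List.flatMap_singleton, hba] at h2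
    rw [hN]
    refine (FreeMonoid.toList.injective ?_)
    rw [toList_apply, flatMap_erase]
    exact h2
  refine hperm ⟨0, fun b hb => ?_, fun hall => ha (hall a ?_)⟩
  · have hb' : b ∈ [a] := hb
    rw [List.mem_singleton.1 hb']
    exact Or.inr hret
  · show a ∈ [a]
    exact List.mem_singleton_self a

/-- Up to erasures of `i`: if some iterate maps `j` to a word whose letters all return to themselves,
then `j` returns to itself. Otherwise `k` does, and the images of `j` and `k` are powers of `k`, which
commute. -/
theorem exists_erasedIterate_eq (hij : i ≠ j) (hik : i ≠ k)
    (hcov : ∀ a, a = i ∨ a = j ∨ a = k) (hg : letterValues g i = [])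
    (hAC : AlmostCommute (erasedIterate i g 1 j) (erasedIterate i g 1 k))
    (hne : ∀ n a, a ≠ i → erasedIterate i g n a ≠ [])
    (hperm : ∃ n, ∀ b ∈ erasedIterate i g n j, ∃ m, erasedIterate i g (m + 1) b = [b]) :
    ∃ m, erasedIterate i g (m + 1) j = [j] := by
  by_contra hj
  obtain ⟨n, hn⟩ := hperm
  obtain ⟨m, hk⟩ : ∃ m, erasedIterate i g (m + 1) k = [k] := by
    obtain ⟨b, hb⟩ := List.exists_mem_of_ne_nil _ (hne n j hij.symm)
    rcases hcov b with rfl | rfl | rfl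
    exacts [absurd rfl (ne_of_mem_erasedIterate hb), absurd (hn _ hb) hj, hn _ hb]
  have hlen : (erasedIterate i g 1 k).length ≤ 1 := by
    have h1 := le_length_flatMap (F := erasedIterate i g m) (w := erasedIterate i g 1 k)
      fun a ha => hne m a (ne_of_mem_erasedIterate ha)
    rwa [← erasedIterate_add hg, hk] at h1
  obtain ⟨b, hb⟩ : ∃ b, erasedIterate i g 1 k = [b] := by
    have h1 := List.length_pos_of_ne_nil (hne 1 k hik.symm)
    exact List.length_eq_one_iff.1 (by omega)
  have hbk : b = k := by
    have hbi : b ≠ i := ne_of_mem_erasedIterate (n := 1) (a := k) (g := g) (by simp [hb])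
    refine ((hcov b).resolve_left hbi).resolve_left fun hbj => hj ⟨m, ?_⟩
    have h1 := erasedIterate_add hg 1 (m + 1) k
    rw [add_comm, erasedIterate_add hg, hb, hk, List.flatMap_singleton, List.flatMap_singleton,
      hb, hbj] at h1
    exact h1
  rw [hbk] at hb
  -- The letter `j` does not occur in the image of `j`, so the images of `j` and `k` are powers
  -- of `k`.
  have hnot : j ∉ erasedIterate i g 1 j := by
    intro hmem
    refine hj (hn j ?_)
    clear hn
    induction n with
    | zero => rw [erasedIterate_zero hij.symm]; exact List.mem_singleton_self j
    | succ n ih =>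
      rw [add_comm, erasedIterate_add hg]
      exact List.mem_flatMap.2 ⟨j, ih, hmem⟩
  have hrep : erasedIterate i g 1 j = List.replicate (erasedIterate i g 1 j).length k := by
    refine List.eq_replicate_of_mem fun b hb => ?_
    refine ((hcov b).resolve_left (ne_of_mem_erasedIterate hb)).resolve_left ?_
    rintro rfl
    exact hnot hb
  refine hAC.append_ne ?_
  rw [hrep, hb]
  show List.replicate _ k ++ List.replicate 1 k = List.replicate 1 k ++ List.replicate _ k
  rw [← List.replicate_add, ← List.replicate_add, add_comm]

/-- If a unit erases `i`, then, up to erasures of `i`, it maps letters to letters. -/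
theorem IsUnitMorphism.length_eq_one (hij : i ≠ j) (hik : i ≠ k)
    (hcov : ∀ a, a = i ∨ a = j ∨ a = k) (hg : letterValues g i = [])
    (hAC : AlmostCommute (erasedIterate i g 1 j) (erasedIterate i g 1 k))
    (hu : IsUnitMorphism g) :
    (erasedIterate i g 1 j).length = 1 ∧ (erasedIterate i g 1 k).length = 1 := by
  have h1ne : ∀ a, a ≠ i → erasedIterate i g 1 a ≠ [] := by
    intro a ha
    rcases (hcov a).resolve_left ha with rfl | rfl
    exacts [hAC.left_ne_nil, hAC.right_ne_nil]
  have hne : ∀ n a, a ≠ i → erasedIterate i g n a ≠ [] := by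
    intro n
    induction n with
    | zero => intro a ha; simp [erasedIterate_zero ha]
    | succ n ih =>
      intro a ha h
      rw [erasedIterate_add hg, List.flatMap_eq_nil_iff] at h
      obtain ⟨b, hb⟩ := List.exists_mem_of_ne_nil _ (h1ne a ha)
      exact ih b (ne_of_mem_erasedIterate hb) (h b hb)
  have hnil : ∀ a, a ≠ i → a ∉ nilpotentLetters g := by
    rintro a ha ⟨n, hn⟩
    refine hne n a ha ?_
    rw [erasedIterate, show letterValues (g ^ n) a = [] from hn, eraseLetter_nil]
  have hN : nilpotentLetters g = {i} := by
    ext a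
    refine ⟨fun ha => by_contra fun h => hnil a h ha, ?_⟩
    rintro rfl
    exact ⟨1, letterValues_pow_self hg 0⟩
  have hperm : ∀ a, a ≠ i →
      ∃ n, ∀ b ∈ erasedIterate i g n a, ∃ m, erasedIterate i g (m + 1) b = [b] := by
    intro a ha
    have hpa : a ∈ permutingLetters g := by
      by_contra hpa
      exact hu.2 ⟨a, hnil a ha, hpa⟩
    obtain ⟨n, hn, -⟩ := hpa
    refine ⟨n, fun b hb => ?_⟩
    obtain ⟨hb, hbi⟩ := mem_eraseLetter.1 hb
    obtain ⟨m, hm, hret⟩ := (hn b hb).resolve_left (hnil b hbi)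
    obtain ⟨m, rfl⟩ := Nat.exists_eq_add_of_le' hm
    refine ⟨m, ?_⟩
    rw [hN] at hret
    have := congrArg FreeMonoid.toList hret
    rw [toList_apply, flatMap_erase] at this
    exact this
  have hlen : ∀ a, a ≠ i → (∃ m, erasedIterate i g (m + 1) a = [a]) →
      (erasedIterate i g 1 a).length = 1 := by
    rintro a ha ⟨m, hm⟩
    have h1 := le_length_flatMap (F := erasedIterate i g m) (w := erasedIterate i g 1 a)
      fun b hb => hne m b (ne_of_mem_erasedIterate hb)
    rw [← erasedIterate_add hg, hm, List.length_singleton] at h1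
    have := List.length_pos_of_ne_nil (h1ne a ha)
    omega
  exact ⟨hlen j hij.symm (exists_erasedIterate_eq hij hik hcov hg hAC hne (hperm j hij.symm)),
    hlen k hik.symm (exists_erasedIterate_eq hik hij (fun a => by have := hcov a; tauto) hg
      hAC.symm hne (hperm k hik.symm))⟩

end Units

/-! ### Prime morphisms -/

section Prime

variable {i j k : Fin 3} {f g h : Morphism (Fin 3)}

theorem isWordPrefix_iff {a b : Fin 3} :
    IsWordPrefix (f (FreeMonoid.of a)) (f (FreeMonoid.of b)) ↔
      letterValues f a <+: letterValues f b :=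
  ⟨fun ⟨v, hv⟩ => ⟨v, hv.symm⟩, fun ⟨v, hv⟩ => ⟨v, hv.symm⟩⟩

theorem isWordSuffix_iff {a b : Fin 3} :
    IsWordSuffix (f (FreeMonoid.of a)) (f (FreeMonoid.of b)) ↔
      letterValues f a <:+ letterValues f b :=
  ⟨fun ⟨v, hv⟩ => ⟨v, hv.symm⟩, fun ⟨v, hv⟩ => ⟨v, hv.symm⟩⟩

/-- In a product `g * h` with `h` not a unit, one of the images of `j` and `k` is a prefix or a
suffix of the other one, because this holds for `h` up to erasures of `i`. -/
theorem isUnitMorphism_right (hij : i ≠ j) (hik : i ≠ k) (hjk : j ≠ k)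
    (hcov : ∀ a, a = i ∨ a = j ∨ a = k) (hg : g ∈ MSEAt i) (hh : h ∈ MSEAt i)
    (h1 : ¬ letterValues (g * h) j <+: letterValues (g * h) k)
    (h2 : ¬ letterValues (g * h) j <:+ letterValues (g * h) k)
    (h3 : ¬ letterValues (g * h) k <+: letterValues (g * h) j)
    (h4 : ¬ letterValues (g * h) k <:+ letterValues (g * h) j) : IsUnitMorphism h := by
  obtain ⟨hgi, -⟩ := (mem_MSEAt_iff hij hik hjk hcov).1 hg
  obtain ⟨hhi, hAC⟩ := (mem_MSEAt_iff hij hik hjk hcov).1 hh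
  have hgh : ∀ a, letterValues (g * h) a =
      (eraseLetter i (letterValues h a)).flatMap (letterValues g) := by
    intro a
    rw [letterValues_mul, flatMap_eraseLetter hgi]
  simp only [hgh] at h1 h2 h3 h4
  have hmem : ∀ {a x : Fin 3}, eraseLetter i (letterValues h a) = [x] → x ≠ i := by
    intro a x hx
    exact (mem_eraseLetter.1 (hx ▸ List.mem_singleton_self x)).2
  obtain ⟨x, y, hxy, hx, hy⟩ : ∃ x y, x ≠ y ∧ eraseLetter i (letterValues h j) = [x] ∧
      eraseLetter i (letterValues h k) = [y] := by
    rcases le_total (eraseLetter i (letterValues h j)).length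
      (eraseLetter i (letterValues h k)).length with hle | hle
    · rcases (hAC i).isPrefix_or_isSuffix hle with hp | hs | hxy
      · exact absurd (hp.flatMap _) h1
      · exact absurd (hs.flatMap _) h2
      · exact hxy
    · rcases (hAC i).symm.isPrefix_or_isSuffix hle with hp | hs | ⟨x, y, hxy, hx, hy⟩
      · exact absurd (hp.flatMap _) h3
      · exact absurd (hs.flatMap _) h4
      · exact ⟨y, x, hxy.symm, hy, hx⟩
  refine isUnitMorphism_of_forall hij hhi fun a ha => ?_
  simp only [erasedIterate_one]
  rcases (hcov x).resolve_left (hmem hx) with rfl | rfl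
  · obtain rfl := ((hcov y).resolve_left (hmem hy)).resolve_left hxy.symm
    rcases (hcov a).resolve_left ha with rfl | rfl
    exacts [⟨a, ha, hx, hx⟩, ⟨a, ha, hy, hy⟩]
  · obtain rfl := ((hcov y).resolve_left (hmem hy)).resolve_right hxy.symm
    rcases (hcov a).resolve_left ha with rfl | rfl
    exacts [⟨x, hmem hx, hx, hy⟩, ⟨y, hmem hy, hy, hx⟩]

/-- If the word obtained from `l` by erasing `i` is a letter `c`, and erasing `c` does not give
the empty word, then `l` contains `i`. -/
theorem one_le_count {c : Fin 3} {l : List (Fin 3)} (h1 : eraseLetter i l = [c])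
    (h2 : eraseLetter c l ≠ []) : 1 ≤ l.count i := by
  obtain ⟨x, hx⟩ := List.exists_mem_of_ne_nil _ h2
  obtain ⟨hxl, hxc⟩ := mem_eraseLetter.1 hx
  have hxi : x = i := by
    by_contra hxi
    exact hxc (List.mem_singleton.1 (h1 ▸ mem_eraseLetter.2 ⟨hxl, hxi⟩))
  rw [← hxi]
  exact List.count_pos_iff.2 hxl

theorem count_add_count (hij : i ≠ j) (hik : i ≠ k) (hjk : j ≠ k)
    (hcov : ∀ a, a = i ∨ a = j ∨ a = k) (l : List (Fin 3)) :
    l.count j + l.count k = (eraseLetter i l).length := by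
  induction l with
  | nil => rfl
  | cons b l ih =>
    rcases hcov b with rfl | rfl | rfl
    · simp [hij, hik, ih]
    · rw [eraseLetter_cons_of_ne hij.symm]
      simp [hjk, ← ih]
      omega
    · rw [eraseLetter_cons_of_ne hik.symm]
      simp [hjk.symm, ← ih]
      omega

/-- If `f(j)` is a prefix or a suffix of `f(k)`, then `f` is the product of a morphism `g` with
`g(j) = f(j)` and of one that is `j ↦ j, k ↦ jk` or `j ↦ j, k ↦ kj` up to erasures of `i`. The
latter is not a unit, and `g` is not one if the letter `i` does not occur too often. -/
theorem not_isPrimeIn (hij : i ≠ j) (hik : i ≠ k) (hjk : j ≠ k)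
    (hcov : ∀ a, a = i ∨ a = j ∨ a = k) (hf : f ∈ MSEAt i)
    (hcount : (letterValues f j ++ letterValues f k).count i <
      (letterValues f j ++ letterValues f k).count j +
        (letterValues f j ++ letterValues f k).count k)
    (h : letterValues f j <+: letterValues f k ∨ letterValues f j <:+ letterValues f k) :
    ¬ IsPrimeIn (MSEAt i) f := by
  obtain ⟨hfi, hAC⟩ := (mem_MSEAt_iff hij hik hjk hcov).1 hf
  have hbase := erasuresAlmostCommute_base hij hik hjk hcov
  obtain ⟨v, u, hv, hk, hu, hfk, huAC⟩ : ∃ v u : List (Fin 3),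
      ErasuresAlmostCommute (letterValues f j) v ∧
      (∀ a, (letterValues f k).count a = (letterValues f j).count a + v.count a) ∧
      (eraseLetter i u = [j, k] ∨ eraseLetter i u = [k, j]) ∧
      letterValues f k = u.flatMap (fun b => if b = j then letterValues f j else
        if b = k then v else []) ∧ ErasuresAlmostCommute [j, i] u := by
    rcases h with ⟨v, hv⟩ | ⟨v, hv⟩
    · refine ⟨v, [j, i] ++ [k, i], fun a => ?_, fun a => ?_, Or.inl ?_, ?_, fun a => ?_⟩
      · have := hAC a
        rw [← hv, eraseLetter_append] at this
        exact this.of_append_right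
      · rw [← hv, List.count_append]
      · simp [eraseLetter_cons_of_ne, hij.symm, hik.symm]
      · simp [← hv, hjk.symm, hij, hik]
      · rw [eraseLetter_append]
        exact (hbase a).append_right
    · refine ⟨v, [k, i] ++ [j, i], fun a => ?_, fun a => ?_, Or.inr ?_, ?_, fun a => ?_⟩
      · have := hAC a
        rw [← hv, eraseLetter_append] at this
        exact this.of_append_left
      · rw [← hv, List.count_append, add_comm]
      · simp [eraseLetter_cons_of_ne, hij.symm, hik.symm]
      · simp [← hv, hjk.symm, hij, hik]
      · rw [eraseLetter_append]
        exact (hbase a).append_left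
  rintro ⟨-, hprime⟩
  set g := pairMor j k (letterValues f j) v with hg
  set h := pairMor j k [j, i] u with hh
  have hgi : letterValues g i = [] := by simp [hg, letterValues_pairMor, hij, hik]
  have hgj : letterValues g j = letterValues f j := by simp [hg, letterValues_pairMor]
  have hgk : letterValues g k = v := by simp [hg, letterValues_pairMor, hjk.symm]
  have hhi : letterValues h i = [] := by simp [hh, letterValues_pairMor, hij, hik]
  have hhj : letterValues h j = [j, i] := by simp [hh, letterValues_pairMor]
  have hhk : letterValues h k = u := by simp [hh, letterValues_pairMor, hjk.symm]
  have hgM : g ∈ MSEAt i := (mem_MSEAt_iff hij hik hjk hcov).2 ⟨hgi, by rwa [hgj, hgk]⟩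
  have hhM : h ∈ MSEAt i := (mem_MSEAt_iff hij hik hjk hcov).2 ⟨hhi, by rwa [hhj, hhk]⟩
  have hfgh : f = g * h := by
    refine FreeMonoid.hom_eq fun b => ?_
    show letterValues f b = letterValues (g * h) b
    rw [letterValues_mul]
    rcases hcov b with rfl | rfl | rfl
    · rw [hfi, hhi]; rfl
    · rw [hhj]; simp [hgj, hgi]
    · rw [hhk, hfk]
      congr 1
  rcases hprime g hgM h hhM hfgh with hunit | hunit
  · obtain ⟨h1, h2⟩ := hunit.length_eq_one hij hik hcov hgi (by
      rw [erasedIterate_one, erasedIterate_one, hgj, hgk]; exact hv i)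
    rw [erasedIterate_one] at h1 h2
    obtain ⟨x, hx⟩ := List.length_eq_one_iff.1 h1
    obtain ⟨y, hy⟩ := List.length_eq_one_iff.1 h2
    rw [hgj] at hx h1
    rw [hgk] at hy h2
    have c1 := one_le_count hx (hv x).left_ne_nil
    have c2 := one_le_count hy (hv y).right_ne_nil
    have c3 := count_add_count hij hik hjk hcov (letterValues f j)
    have c4 := count_add_count hij hik hjk hcov v
    simp only [List.count_append, hk] at hcount
    omega
  · obtain ⟨-, h2⟩ := hunit.length_eq_one hij hik hcov hhi (by
      rw [erasedIterate_one, erasedIterate_one, hhj, hhk]; exact huAC i)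
    rw [erasedIterate_one, hhk] at h2
    rcases hu with hu | hu <;> simp [hu] at h2

theorem occurrences_eq (hij : i ≠ j) (hik : i ≠ k) (hjk : j ≠ k)
    (hcov : ∀ a, a = i ∨ a = j ∨ a = k) (hfi : letterValues f i = []) (a : Fin 3) :
    occurrences a (f (FreeMonoid.of 0 * FreeMonoid.of 1 * FreeMonoid.of 2)) =
      (letterValues f j ++ letterValues f k).count a := by
  have h1 : occurrences a (f (FreeMonoid.of 0 * FreeMonoid.of 1 * FreeMonoid.of 2)) =
      ∑ b, (letterValues f b).count a := by
    rw [Fin.sum_univ_three, occurrences, toList_apply]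
    show ([0, 1, 2].flatMap (letterValues f)).count a = _
    simp [add_assoc]
  have h2 : (Finset.univ : Finset (Fin 3)) = {i, j, k} := by
    ext b
    simpa using hcov b
  rw [h1, h2, Finset.sum_insert (by simp [hij, hik]), Finset.sum_pair hjk, hfi]
  simp

end Prime

end SturmianErasures

theorem mainTheorem3 (i j k : Fin 3) (hijk : ({i, j, k} : Set (Fin 3)) = Set.univ)
    (f : SturmianErasures.Morphism (Fin 3)) (hf : f ∈ SturmianErasures.MSEAt i) :
    ((¬ SturmianErasures.IsWordPrefix (f (FreeMonoid.of j)) (f (FreeMonoid.of k)) ∧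
        ¬ SturmianErasures.IsWordSuffix (f (FreeMonoid.of j)) (f (FreeMonoid.of k)) ∧
        ¬ SturmianErasures.IsWordPrefix (f (FreeMonoid.of k)) (f (FreeMonoid.of j)) ∧
        ¬ SturmianErasures.IsWordSuffix (f (FreeMonoid.of k)) (f (FreeMonoid.of j))) →
      SturmianErasures.IsPrimeIn (SturmianErasures.MSEAt i) f) ∧
    ((SturmianErasures.IsPrimeIn (SturmianErasures.MSEAt i) f ∧
        SturmianErasures.occurrences k
            (f (FreeMonoid.of 0 * FreeMonoid.of 1 * FreeMonoid.of 2)) <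
          SturmianErasures.occurrences j
            (f (FreeMonoid.of 0 * FreeMonoid.of 1 * FreeMonoid.of 2)) ∧
        SturmianErasures.occurrences i
            (f (FreeMonoid.of 0 * FreeMonoid.of 1 * FreeMonoid.of 2)) ≤
          SturmianErasures.occurrences k
            (f (FreeMonoid.of 0 * FreeMonoid.of 1 * FreeMonoid.of 2))) →
      ¬ SturmianErasures.IsWordPrefix (f (FreeMonoid.of j)) (f (FreeMonoid.of k)) ∧
        ¬ SturmianErasures.IsWordSuffix (f (FreeMonoid.of j)) (f (FreeMonoid.of k)) ∧
        ¬ SturmianErasures.IsWordPrefix (f (FreeMonoid.of k)) (f (FreeMonoid.of j)) ∧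
        ¬ SturmianErasures.IsWordSuffix (f (FreeMonoid.of k)) (f (FreeMonoid.of j))) := by
  open SturmianErasures in
  have hcov : ∀ a, a = i ∨ a = j ∨ a = k := fun a => by
    have : a ∈ ({i, j, k} : Set (Fin 3)) := hijk ▸ Set.mem_univ a
    simpa using this
  have hdist : ∀ i j k : Fin 3, (∀ a, a = i ∨ a = j ∨ a = k) → i ≠ j ∧ i ≠ k ∧ j ≠ k := by decide
  obtain ⟨hij, hik, hjk⟩ := hdist i j k hcov
  have hcov' : ∀ a, a = i ∨ a = k ∨ a = j := fun a => (hcov a).imp_right Or.symm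
  simp only [isWordPrefix_iff, isWordSuffix_iff]
  constructor
  · rintro ⟨h1, h2, h3, h4⟩
    refine ⟨hf, fun g hg h hh hfgh => Or.inr ?_⟩
    subst hfgh
    exact isUnitMorphism_right hij hik hjk hcov hg hh h1 h2 h3 h4
  · rintro ⟨hprime, hc1, hc2⟩
    have hfi : letterValues f i = [] := hf.2
    simp only [occurrences_eq hij hik hjk hcov hfi] at hc1 hc2
    have hjk' := fun h => not_isPrimeIn hij hik hjk hcov hf (by omega) h hprime
    have hkj' := fun h => not_isPrimeIn hik hij hjk.symm hcov' hf
      (by simp only [List.count_append] at hc1 hc2 ⊢; omega) h hprime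
    exact ⟨fun h => hjk' (Or.inl h), fun h => hjk' (Or.inr h), fun h => hkj' (Or.inl h),
      fun h => hkj' (Or.inr h)⟩
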